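/- Setting. Let $\mathcal S,\mathcal A$ be measurable spaces, $P_S$ a probability distribution on $\mathcal S$, $P_R(\cdot\mid s,a)$ a Markov kernel from $\mathcal S\times\mathcal A$ to $\mathbb R$, and let $\pi_b,\pi_e$ (behavior and target policy) be given by conditional densities $\pi_b(a\mid s),\pi_e(a\mid s)$ with respect to a common reference measure $da$ on $\mathcal A$ (which may depend on $s$). Assume that $$B=\inf\{b:\pi_e(a\mid s)\le b\,\pi_b(a\mid s)\text{ for all }(s,a)\}<\infty,$$ and put $w(s,a)=\pi_e(a\mid s)/\pi_b(a\mid s)$, with $0/0=0$. The data $\mathcal D=(S_i,A_i,R_i)_{i=1}^n$ are i.i.d. with $S_i\sim P_S$, $A_i\sim\pi_b(\cdot\mid S_i)$, $R_i\sim P_R(\cdot\mid S_i,A_i)$; $V_1,V_2,\dots$ are i.i.d. uniform on $[0,1]$ and independent of the data; $(S_{n+1},A_{n+1},R_{n+1})$ is independent of $\mathcal D$ and $(V_i)$ and satisfies $S_{n+1}\sim P_S$, $A_{n+1}\sim\pi_e(\cdot\mid S_{n+1})$, $R_{n+1}\sim P_R(\cdot\mid S_{n+1},A_{n+1})$. Algorithm.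 Let $\epsilon,\delta,\gamma\in(0,1)$ and let $\epsilon_{\rm lo},\epsilon_{\rm up}$ satisfy $\epsilon_{\rm up}-\epsilon_{\rm lo}=1-\epsilon$. Keep the pairs $(S_i,R_i)$, $i\le n$, with $V_i\le w(S_i,A_i)/B$, in their original order, and let $N$ be their number. Split them, by a fixed rule on their positions, into a calibration part of size $M=\lceil\gamma N\rceil$ and a training part of size $N-M$. By an arbitrary (non-randomized, measurable) algorithm compute from the training part two functions $\hat q_{\rm lo},\hat q_{\rm up}:\mathcal S\to\mathbb R$ (estimates of the conditional quantiles of $R$ given $S$ at the levels $\epsilon_{\rm lo},\epsilon_{\rm up}$). Let $\tau_{(1)}\le\dots\le\tau_{(M)}$ be the ordered values of the scores $\tau_i=\max\{\hat q_{\rm lo}(S_i)-R_i,\ R_i-\hat q_{\rm up}(S_i)\}$ over the calibration part, let $\tau_{(M+1)}=\infty$, and put $$k=\max\{j\in\{-1,0,\dots,M-1\}:F_{\mathrm{Bin}(M,\epsilon)}(j)\le\delta\},\qquad \tilde\tau=\tau_{(M-k)},\qquad \hat C_{\tilde\tau}(s)=[\hat q_{\rm lo}(s)-\tilde\tau,\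 \hat q_{\rm up}(s)+\tilde\tau].$$ Let $L=L_n=\mathbb P[R_{n+1}\notin\hat C_{\tilde\tau}(S_{n+1})\mid\mathcal D,V_1,\dots,V_n]$ be the miscoverage of the resulting interval. Statement. Assume that for every $n\ge1$ there are almost surely no ties among the calibration scores $\tau_i$. Let $(\Delta_n)$ be a positive sequence with $\Delta_n\to0$ and $1/(\sqrt n\,\Delta_n)\to0$. Then there is a constant $C>0$, depending only on $\epsilon,\delta,\gamma,B$ and the sequence $(\Delta_n)$, such that for all $n\ge1$ $$\mathbb P[\epsilon-\Delta_n<L_n\le\epsilon]>1-\delta-\frac{C}{\sqrt n\,\Delta_n}\qquad\text{and}\qquad \mathbb P[\epsilon<L_n\le\epsilon+\Delta_n]>\delta-\frac{C}{\sqrt n\,\Delta_n}.$$ Consequently $\mathbb P[\epsilon-\Delta_n<L_n\le\epsilon+\Delta_n]\to1$, and the coverage $1-L_n$ converges to $1-\epsilon$ in probability. -/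

import Mathlib

open MeasureTheory ProbabilityTheory Filter Topology
open scoped ENNReal NNReal

noncomputable section

namespace OffPolicy

/-- A policy `s ↦ π(· ∣ s)`: a jointly measurable family of probability densities `π(a ∣ s)` with
respect to a reference measure `da` on the actions.  The reference measure is given as a kernel
`ν`, so that it may depend on the context; the usual case is a constant kernel (Lebesgue measure,
counting measure, ...). -/
structure Policy {𝒮 𝒜 : Type*} [MeasurableSpace 𝒮] [MeasurableSpace 𝒜] (ν : Kernel 𝒮 𝒜) where
  dens : 𝒮 → 𝒜 → ℝ≥0
  measurable_dens : Measurable (Function.uncurry dens)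
  lintegral_dens : ∀ s, ∫⁻ a, (dens s a : ℝ≥0∞) ∂(ν s) = 1

/-- The conditional law `π(a ∣ s) da` of the action given the context. -/
def Policy.kernel {𝒮 𝒜 : Type*} [MeasurableSpace 𝒮] [MeasurableSpace 𝒜] {ν : Kernel 𝒮 𝒜}
    [IsSFiniteKernel ν] (π : Policy ν) : Kernel 𝒮 𝒜 :=
  ν.withDensity fun s a => (π.dens s a : ℝ≥0∞)

instance Policy.isMarkovKernel_kernel {𝒮 𝒜 : Type*} [MeasurableSpace 𝒮] [MeasurableSpace 𝒜]
    {ν : Kernel 𝒮 𝒜} [IsSFiniteKernel ν] (π : Policy ν) : IsMarkovKernel π.kernel := by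
  refine ⟨fun s => ⟨?_⟩⟩
  have h : Measurable (Function.uncurry fun s a => (π.dens s a : ℝ≥0∞)) :=
    π.measurable_dens.coe_nnreal_ennreal
  rw [Policy.kernel, Kernel.withDensity_apply' _ h, Measure.restrict_univ]
  exact π.lintegral_dens s

/-- The joint law of `((S, A), R)` when `S ∼ P_S`, `A ∼ π(· ∣ S)` and `R ∼ P_R(· ∣ S, A)`. -/
def jointLaw {𝒮 𝒜 : Type*} [MeasurableSpace 𝒮] [MeasurableSpace 𝒜] {ν : Kernel 𝒮 𝒜}
    [IsSFiniteKernel ν] (PS : Measure 𝒮) (PR : Kernel (𝒮 × 𝒜) ℝ) (π : Policy ν) :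
    Measure ((𝒮 × 𝒜) × ℝ) :=
  (PS ⊗ₘ π.kernel) ⊗ₘ PR

/-- The weight `w(s, a) = π_e(a ∣ s) / π_b(a ∣ s)`, with `0 / 0 = 0`. -/
def weight {𝒮 𝒜 : Type*} [MeasurableSpace 𝒮] [MeasurableSpace 𝒜] {ν : Kernel 𝒮 𝒜}
    (πe πb : Policy ν) (s : 𝒮) (a : 𝒜) : ℝ :=
  (πe.dens s a : ℝ) / (πb.dens s a : ℝ)

/-- The set of all `b` with `π_e(a ∣ s) ≤ b π_b(a ∣ s)` for all `(s, a)`. -/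
def dominatingConstants {𝒮 𝒜 : Type*} [MeasurableSpace 𝒮] [MeasurableSpace 𝒜] {ν : Kernel 𝒮 𝒜}
    (πe πb : Policy ν) : Set ℝ :=
  {b | ∀ s a, (πe.dens s a : ℝ) ≤ b * (πb.dens s a : ℝ)}

/-- The constant `B = inf {b : π_e(a ∣ s) ≤ b π_b(a ∣ s) for all (s, a)}`; the case `B = ∞` is the
case where `dominatingConstants πe πb` is empty, which has to be excluded separately. -/
def ratioBound {𝒮 𝒜 : Type*} [MeasurableSpace 𝒮] [MeasurableSpace 𝒜] {ν : Kernel 𝒮 𝒜}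
    (πe πb : Policy ν) : ℝ :=
  sInf (dominatingConstants πe πb)

/-! ### Rejection sampling -/

/-- The indices `i` that rejection sampling keeps: `V_i ≤ w(S_i, A_i) / B`. -/
def accepted {𝒮 𝒜 : Type*} [MeasurableSpace 𝒮] [MeasurableSpace 𝒜] {ν : Kernel 𝒮 𝒜}
    (πe πb : Policy ν) {n : ℕ} (x : Fin n → (𝒮 × 𝒜) × ℝ) (v : Fin n → ℝ) : Finset (Fin n) :=
  Finset.univ.filter fun i => v i ≤ 1 / ratioBound πe πb * weight πe πb (x i).1.1 (x i).1.2

/-- The retained pairs `Z_1, …, Z_N` of contexts and rewards, `N = #accepted`, in the order of their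
original indices. -/
def rsSample {𝒮 𝒜 : Type*} [MeasurableSpace 𝒮] [MeasurableSpace 𝒜] {ν : Kernel 𝒮 𝒜}
    (πe πb : Policy ν) {n : ℕ} (x : Fin n → (𝒮 × 𝒜) × ℝ) (v : Fin n → ℝ) :
    Fin (accepted πe πb x v).card → 𝒮 × ℝ :=
  fun j =>
    let i := (accepted πe πb x v).orderEmbOfFin rfl j
    ((x i).1.1, (x i).2)

/-! ### Splitting and quantile regression -/

/-- A rule that splits `N` data points into a training part and a calibration part with
`⌈γ N⌉` points.  `calib N` is the set of the indices of the calibration points. -/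
structure SplitRule (γ : ℝ) where
  calib : ∀ N : ℕ, Finset (Fin N)
  card_calib : ∀ N : ℕ, (calib N).card = ⌈γ * (N : ℝ)⌉₊

/-- A (non-randomized) conditional quantile regression algorithm: from a level `α` and a training
sample of any size it computes a function of the context, jointly measurable in the training sample
and the context.  Nothing is assumed on its accuracy. -/
structure QuantileAlgorithm (𝒮 : Type*) [MeasurableSpace 𝒮] where
  fit : ℝ → ∀ l : ℕ, (Fin l → 𝒮 × ℝ) → 𝒮 → ℝ
  measurable_fit : ∀ (α : ℝ) (l : ℕ),
    Measurable fun p : (Fin l → 𝒮 × ℝ) × 𝒮 => fit α l p.1 p.2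

/-- The conditional quantile function at level `α` computed from the training part of `z`. -/
def fitTraining {𝒮 : Type*} [MeasurableSpace 𝒮] {γ : ℝ} (sp : SplitRule γ)
    (alg : QuantileAlgorithm 𝒮) (α : ℝ) {N : ℕ} (z : Fin N → 𝒮 × ℝ) : 𝒮 → ℝ :=
  alg.fit α ((sp.calib N)ᶜ).card fun j => z (((sp.calib N)ᶜ).orderEmbOfFin rfl j)

/-- The non-conformity score `max (q_lo(s) - r) (r - q_up(s))`. -/
def score {𝒮 : Type*} (qlo qup : 𝒮 → ℝ) (p : 𝒮 × ℝ) : ℝ :=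
  max (qlo p.1 - p.2) (p.2 - qup p.1)

/-! ### Calibration -/

/-- The distribution function `F(k) = ∑_{i ≤ k} (M choose i) p^i (1 - p)^(M - i)` of the binomial
distribution `Bin(M, p)`, at integers `k ≥ -1` (it vanishes at `k = -1`). -/
def binomCDF (M : ℕ) (p : ℝ) (k : ℤ) : ℝ :=
  ∑ i ∈ Finset.range (k + 1).toNat, (M.choose i : ℝ) * p ^ i * (1 - p) ^ (M - i)

/-- `k(M, ε, δ) = max {k ∈ {-1, 0, …, M - 1} : F_{Bin(M, ε)}(k) ≤ δ}`. -/
def cutoff (M : ℕ) (ε δ : ℝ) : ℤ :=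
  sSup {k : ℤ | -1 ≤ k ∧ k ≤ (M : ℤ) - 1 ∧ binomCDF M ε k ≤ δ}

/-- The threshold `τ_(M - k(M, ε, δ))`, where `τ_(1) ≤ … ≤ τ_(M)` are the sorted calibration scores
and `τ_(M+1) = ∞`.  The list is indexed from `0`, and its default value `⊤` stands for
`τ_(M+1)`. -/
def threshold {ι : Type*} (ε δ : ℝ) (I : Finset ι) (τ : ι → ℝ) : EReal :=
  ((I.val.map fun i => (τ i : EReal)).sort (· ≤ ·)).getD
    ((I.card : ℤ) - cutoff I.card ε δ - 1).toNat ⊤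

/-- The interval `[q_lo(s) - τ, q_up(s) + τ]`, which is `ℝ` for `τ = ∞`. -/
def interval {𝒮 : Type*} (qlo qup : 𝒮 → ℝ) (τ : EReal) (s : 𝒮) : Set ℝ :=
  {r : ℝ | (qlo s : EReal) - τ ≤ (r : EReal) ∧ (r : EReal) ≤ (qup s : EReal) + τ}

/-- The scores `τ_j` of the points of `z`, for the quantile functions computed from the training
part of `z`. -/
def scores {𝒮 : Type*} [MeasurableSpace 𝒮] {γ : ℝ} (sp : SplitRule γ)
    (alg : QuantileAlgorithm 𝒮) (εlo εup : ℝ) {N : ℕ} (z : Fin N → 𝒮 × ℝ) (j : Fin N) : ℝ :=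
  score (fitTraining sp alg εlo z) (fitTraining sp alg εup z) (z j)

/-- The prediction interval computed from the sample `z` that rejection sampling returns. -/
def calibratedInterval {𝒮 : Type*} [MeasurableSpace 𝒮] {γ : ℝ} (sp : SplitRule γ)
    (alg : QuantileAlgorithm 𝒮) (ε δ εlo εup : ℝ) {N : ℕ} (z : Fin N → 𝒮 × ℝ) (s : 𝒮) : Set ℝ :=
  interval (fitTraining sp alg εlo z) (fitTraining sp alg εup z)
    (threshold ε δ (sp.calib N) (scores sp alg εlo εup z)) s

/-- The output of the whole algorithm (with known behavior policy) on the data `x` and the uniform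
variables `v`. -/
def predictionInterval {𝒮 𝒜 : Type*} [MeasurableSpace 𝒮] [MeasurableSpace 𝒜] {ν : Kernel 𝒮 𝒜}
    (πe πb : Policy ν) {γ : ℝ} (sp : SplitRule γ) (alg : QuantileAlgorithm 𝒮) (ε δ εlo εup : ℝ)
    {n : ℕ} (x : Fin n → (𝒮 × 𝒜) × ℝ) (v : Fin n → ℝ) (s : 𝒮) : Set ℝ :=
  calibratedInterval sp alg ε δ εlo εup (rsSample πe πb x v) s

/-- There are no ties among the scores of the calibration points. -/
def NoTies {𝒮 𝒜 : Type*} [MeasurableSpace 𝒮] [MeasurableSpace 𝒜] {ν : Kernel 𝒮 𝒜}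
    (πe πb : Policy ν) {γ : ℝ} (sp : SplitRule γ) (alg : QuantileAlgorithm 𝒮) (εlo εup : ℝ)
    {n : ℕ} (x : Fin n → (𝒮 × 𝒜) × ℝ) (v : Fin n → ℝ) : Prop :=
  Set.InjOn (scores sp alg εlo εup (rsSample πe πb x v))
    (sp.calib (accepted πe πb x v).card : Set (Fin (accepted πe πb x v).card))

/-! ### The random experiment -/

/-- The observations `X_i = ((S_i, A_i), R_i)` are i.i.d. under the behavior policy, the `V_i` are
i.i.d. uniform on `[0, 1]` and independent of the observations, and the future triple
`T = ((S, A), R)` follows the target policy and is independent of all of them. -/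
structure IsExperiment {𝒮 𝒜 Ω : Type*} [MeasurableSpace 𝒮] [MeasurableSpace 𝒜]
    [MeasurableSpace Ω] {ν : Kernel 𝒮 𝒜} [IsSFiniteKernel ν] (P : Measure Ω) (PS : Measure 𝒮)
    (PR : Kernel (𝒮 × 𝒜) ℝ) (πe πb : Policy ν) (X : ℕ → Ω → (𝒮 × 𝒜) × ℝ) (V : ℕ → Ω → ℝ)
    (T : Ω → (𝒮 × 𝒜) × ℝ) : Prop where
  measurable_X : ∀ i, Measurable (X i)
  measurable_V : ∀ i, Measurable (V i)
  measurable_T : Measurable T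
  law_X : ∀ i, P.map (X i) = jointLaw PS PR πb
  law_V : ∀ i, P.map (V i) = volume.restrict (Set.Icc (0 : ℝ) 1)
  law_T : P.map T = jointLaw PS PR πe
  iIndepFun_X : iIndepFun X P
  iIndepFun_V : iIndepFun V P
  indepFun_X_V : IndepFun (fun ω i => X i ω) (fun ω i => V i ω) P
  indepFun_XV_T : IndepFun (fun ω => ((fun i => X i ω), (fun i => V i ω))) T P

/-- The σ-algebra generated by the first `n` observations and the first `n` uniform variables, i.e.
by everything that the prediction interval is computed from. -/
@[reducible] def dataSigma {𝒮 𝒜 Ω : Type*} [MeasurableSpace 𝒮] [MeasurableSpace 𝒜]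
    (X : ℕ → Ω → (𝒮 × 𝒜) × ℝ) (V : ℕ → Ω → ℝ) (n : ℕ) : MeasurableSpace Ω :=
  MeasurableSpace.comap
    (fun ω => ((fun i : Fin n => X i ω), (fun i : Fin n => V i ω))) inferInstance

/-- The miscoverage `L`: the conditional probability, given the data, that the future reward lies
outside the prediction interval at the future context. -/
def miscoverage {𝒮 𝒜 Ω : Type*} [MeasurableSpace 𝒮] [MeasurableSpace 𝒜] [MeasurableSpace Ω]
    {ν : Kernel 𝒮 𝒜} (P : Measure Ω) (πe πb : Policy ν) {γ : ℝ} (sp : SplitRule γ)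
    (alg : QuantileAlgorithm 𝒮) (ε δ εlo εup : ℝ) (X : ℕ → Ω → (𝒮 × 𝒜) × ℝ) (V : ℕ → Ω → ℝ)
    (T : Ω → (𝒮 × 𝒜) × ℝ) (n : ℕ) : Ω → ℝ :=
  P⟦{ω | (T ω).2 ∉ predictionInterval πe πb sp alg ε δ εlo εup
      (fun i : Fin n => X i ω) (fun i : Fin n => V i ω) (T ω).1.1} | dataSigma X V n⟧

end OffPolicy

end

noncomputable section

namespace OffPolicy

/-! ### The binomial distribution -/

/-! Rejection sampling turns behavior data into target data: an observation is kept with conditional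
probability `w / B`, so each kept pair `(S, R)` has the target law. Given which indices are kept,
the kept pairs are i.i.d., and `N` is `Bin(n, 1/B)`. Hence every probability about the kept sample
is a binomial mixture over `N` of probabilities for i.i.d. target samples
(`IsExperiment.measureReal_rsSample_mem`).

Fix `N` and condition on the training part. The calibration scores and the score of the new point
are then i.i.d., and absence of ties means that their law has no atoms once `M ≥ 2`. The miscoverage
is the upper tail mass of this law at an order statistic. It exceeds `α` exactly when at most `k`
calibration scores lie above the upper `α`-quantile, and the number of such scores is `Bin(M, α)`.
So `P(L > α) = F_{Bin(M, α)}(k)`, whatever the quality of the fitted quantiles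
(`measureReal_lt_sampleMiscoverage`).

What remains is an estimate of `F_{Bin(M, α)}(k)` for three values of `α`. At `α = ε` the choice of
`k` makes it at most `δ`, and at least `δ` minus one binomial point mass, which is `O(1/√M)`.
Chebyshev's inequality places `k` within `O(√M)` of `M ε`; a second application shows that the value
is `1 - O(1/(√M Δ))` at `ε - Δ` and `O(1/(√M Δ))` at `ε + Δ`. Differences of these values are the
probabilities of the two windows. Finally `N ≥ n/(2B)` outside an event of probability `O(1/n)`, so
`M` is of order `n` there. -/

/-- The binomial probability mass `(M choose j) p ^ j (1 - p) ^ (M - j)`. -/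
def binomWeight (M : ℕ) (p : ℝ) (j : ℕ) : ℝ :=
  (M.choose j : ℝ) * p ^ j * (1 - p) ^ (M - j)

lemma binomWeight_nonneg {M : ℕ} {p : ℝ} (h0 : 0 ≤ p) (h1 : p ≤ 1) (j : ℕ) :
    0 ≤ binomWeight M p j := by
  have : 0 ≤ 1 - p := by linarith
  unfold binomWeight
  positivity

lemma binomWeight_eq_zero {M : ℕ} {p : ℝ} {j : ℕ} (h : M < j) : binomWeight M p j = 0 := by
  simp [binomWeight, Nat.choose_eq_zero_of_lt h]

lemma sum_binomWeight (M : ℕ) (p : ℝ) : ∑ j ∈ Finset.range (M + 1), binomWeight M p j = 1 := by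
  have h := add_pow p (1 - p) M
  simp only [add_sub_cancel, one_pow] at h
  rw [h]
  refine Finset.sum_congr rfl fun j _ => ?_
  unfold binomWeight
  ring

lemma sum_sq_binomWeight (M : ℕ) (p : ℝ) :
    ∑ j ∈ Finset.range (M + 1), ((M : ℝ) * p - j) ^ 2 * binomWeight M p j
      = M * p * (1 - p) := by
  have h := congrArg (Polynomial.eval p) (bernsteinPolynomial.variance ℝ M)
  simpa [Polynomial.eval_finsetSum, bernsteinPolynomial, binomWeight] using h

/-- Chebyshev's inequality with the variance bounded by `M / 4`, uniformly in `p`. The set `t` is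
arbitrary, so both tails of the calibration count and the lower tail of `N` follow from this one
bound. -/
lemma sum_binomWeight_deviation_le {M : ℕ} {p s : ℝ} (h0 : 0 ≤ p) (h1 : p ≤ 1) (hs : 0 < s)
    (t : Finset ℕ) (ht : ∀ j ∈ t, s ≤ |(M : ℝ) * p - j|) :
    ∑ j ∈ t, binomWeight M p j ≤ M / (4 * s ^ 2) := by
  have key : ∑ j ∈ t, binomWeight M p j * s ^ 2 ≤ M / 4 := by
    calc ∑ j ∈ t, binomWeight M p j * s ^ 2
        ≤ ∑ j ∈ t, ((M : ℝ) * p - j) ^ 2 * binomWeight M p j := by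
          refine Finset.sum_le_sum fun j hj => ?_
          have h2 : s ^ 2 ≤ ((M : ℝ) * p - j) ^ 2 := by
            rw [← sq_abs ((M : ℝ) * p - j)]
            have := ht j hj
            gcongr
          rw [mul_comm]
          exact mul_le_mul_of_nonneg_right h2 (binomWeight_nonneg h0 h1 j)
      _ ≤ ∑ j ∈ t ∪ Finset.range (M + 1), ((M : ℝ) * p - j) ^ 2 * binomWeight M p j :=
          Finset.sum_le_sum_of_subset_of_nonneg Finset.subset_union_left fun j _ _ =>
            mul_nonneg (sq_nonneg _) (binomWeight_nonneg h0 h1 j)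
      _ = ∑ j ∈ Finset.range (M + 1), ((M : ℝ) * p - j) ^ 2 * binomWeight M p j := by
          symm
          refine Finset.sum_subset Finset.subset_union_right fun j _ hj => ?_
          rw [binomWeight_eq_zero (by simpa using hj), mul_zero]
      _ = M * p * (1 - p) := sum_sq_binomWeight M p
      _ ≤ M / 4 := by
          have hM : (0 : ℝ) ≤ M := by positivity
          nlinarith [mul_nonneg hM (sq_nonneg (p - 1 / 2))]
  rw [← Finset.sum_mul] at key
  rw [le_div_iff₀ (by positivity)]
  linarith

lemma binomWeight_succ (M : ℕ) (p : ℝ) (j : ℕ) :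
    binomWeight M p (j + 1) * ((j + 1) * (1 - p)) = binomWeight M p j * ((M - j) * p) := by
  rcases lt_trichotomy j M with h | h | h
  · have hc : (M.choose (j + 1) : ℝ) * (j + 1) = M.choose j * (M - j) := by
      have := Nat.choose_succ_right_eq M j
      have h2 : ((M.choose (j + 1) * (j + 1) : ℕ) : ℝ) = ((M.choose j * (M - j) : ℕ) : ℝ) := by
        rw [this]
      push_cast [Nat.cast_sub h.le] at h2
      exact h2
    have hpow : (1 - p) ^ (M - j) = (1 - p) ^ (M - (j + 1)) * (1 - p) := by
      rw [← pow_succ]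
      congr 1
      omega
    unfold binomWeight
    rw [hpow, pow_succ]
    linear_combination p ^ j * p * (1 - p) ^ (M - (j + 1)) * (1 - p) * hc
  · subst h
    simp [binomWeight]
  · rw [binomWeight_eq_zero h, binomWeight_eq_zero (by omega : M < j + 1)]
    simp

/-- To the right of a point below the mean the masses decay slowly: the ratio of the masses at `j +
s + 1` and `j + s` is at least `1 - (s + 1) / D` with `D = M p (1 - p)`, and these factors multiply
up to at least `1 - s² / D`. -/
lemma binomWeight_add_ge {M : ℕ} {p : ℝ} (hM : 0 < M) (h0 : 0 < p) (h1 : p < 1) {j : ℕ}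
    (hj : (j : ℝ) ≤ M * p) (s : ℕ) :
    binomWeight M p j * (1 - s ^ 2 / (M * p * (1 - p))) ≤ binomWeight M p (j + s) := by
  have hM' : (0 : ℝ) < M := by exact_mod_cast hM
  have hq : 0 < 1 - p := by linarith
  have hD : 0 < M * p * (1 - p) := by positivity
  have hw := binomWeight_nonneg (M := M) h0.le h1.le j
  induction s with
  | zero => simp
  | succ s ih =>
    rcases le_or_gt (1 - ((s + 1 : ℕ) : ℝ) ^ 2 / (M * p * (1 - p))) 0 with hneg | hpos
    · exact (mul_nonpos_of_nonneg_of_nonpos hw hneg).trans (binomWeight_nonneg h0.le h1.le _)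
    have hsq : ((s : ℝ) + 1) ^ 2 < M * p * (1 - p) := by
      have : ((s + 1 : ℕ) : ℝ) ^ 2 / (M * p * (1 - p)) < 1 := by linarith
      rw [div_lt_one hD] at this
      push_cast at this
      exact this
    have hrec := binomWeight_succ M p (j + s)
    push_cast at hrec
    have hws := binomWeight_nonneg (M := M) h0.le h1.le (j + s)
    have hden : 0 < ((j : ℝ) + s + 1) * (1 - p) := by positivity
    have hs0 : (0 : ℝ) ≤ s := by positivity
    have hj0 : (0 : ℝ) ≤ j := by positivity
    -- The ratio decreases in `j`, so the worst case is `j = M p`, where the inequality is explicit.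
    have hratio : 1 - (s + 1) / (M * p * (1 - p))
        ≤ ((M - (j + s)) * p) / (((j : ℝ) + s + 1) * (1 - p)) := by
      have hx : (s : ℝ) + 1 ≤ M * p * (1 - p) := by nlinarith
      rw [le_div_iff₀ hden]
      have hcalc : (1 - ((s : ℝ) + 1) / (M * p * (1 - p))) * (((j : ℝ) + s + 1) * (1 - p))
          ≤ (1 - ((s : ℝ) + 1) / (M * p * (1 - p))) * ((M * p + s + 1) * (1 - p)) := by
        apply mul_le_mul_of_nonneg_left
        · nlinarith
        · rw [sub_nonneg, div_le_one hD]
          exact hx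
      have hcalc2 : (1 - ((s : ℝ) + 1) / (M * p * (1 - p))) * ((M * p + s + 1) * (1 - p))
          ≤ (M - (M * p + s)) * p := by
        have e : (1 - ((s : ℝ) + 1) / (M * p * (1 - p))) * ((M * p + s + 1) * (1 - p))
          = (M * p + s + 1) * (1 - p) - (s + 1) - (s + 1) ^ 2 / (M * p) := by
          field_simp
          ring
        rw [e]
        have : 0 ≤ ((s : ℝ) + 1) ^ 2 / (M * p) := by positivity
        nlinarith
      have hcalc3 : ((M : ℝ) - (M * p + s)) * p ≤ (M - (j + s)) * p := by
        apply mul_le_mul_of_nonneg_right _ h0.le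
        linarith
      linarith
    have hstep : binomWeight M p (j + (s + 1))
        = binomWeight M p (j + s) * (((M - (j + s)) * p) / (((j : ℝ) + s + 1) * (1 - p))) := by
      rw [mul_div_assoc', eq_div_iff hden.ne', ← add_assoc]
      linarith
    rw [hstep]
    have hs1 : (s : ℝ) ^ 2 / (M * p * (1 - p)) ≤ 1 := by
      rw [div_le_one hD]
      nlinarith
    have hs2 : ((s : ℝ) + 1) / (M * p * (1 - p)) ≤ 1 := by
      rw [div_le_one hD]
      nlinarith
    calc binomWeight M p j * (1 - ((s + 1 : ℕ) : ℝ) ^ 2 / (M * p * (1 - p)))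
        ≤ binomWeight M p j * ((1 - s ^ 2 / (M * p * (1 - p)))
            * (1 - (s + 1) / (M * p * (1 - p)))) := by
          apply mul_le_mul_of_nonneg_left _ hw
          have : ((s : ℝ) + 1) ^ 2 / (M * p * (1 - p))
            = s ^ 2 / (M * p * (1 - p)) + (s + 1) / (M * p * (1 - p))
              + s / (M * p * (1 - p)) := by ring
          push_cast
          rw [this]
          have a0 : 0 ≤ (s : ℝ) / (M * p * (1 - p)) := by positivity
          have a1 : 0 ≤ (s : ℝ) ^ 2 / (M * p * (1 - p)) := by positivity
          have a2 : 0 ≤ ((s : ℝ) + 1) / (M * p * (1 - p)) := by positivity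
          nlinarith [mul_nonneg a1 a2]
      _ ≤ binomWeight M p (j + s) * (1 - (s + 1) / (M * p * (1 - p))) := by
          rw [← mul_assoc]
          apply mul_le_mul_of_nonneg_right ih
          linarith
      _ ≤ _ := mul_le_mul_of_nonneg_left hratio hws

/-- About `√(D / 2)` masses to the right of `j` are at least half of the mass at `j`. Their sum is
at most `1`, which leaves `2 / √(D / 2) ≤ 3 / √D` for that mass. -/
lemma binomWeight_le_of_le_mean {M : ℕ} {p : ℝ} (hM : 0 < M) (h0 : 0 < p) (h1 : p < 1) {j : ℕ}
    (hj : (j : ℝ) ≤ M * p) : binomWeight M p j ≤ 3 / √(M * p * (1 - p)) := by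
  have hM' : (0 : ℝ) < M := by exact_mod_cast hM
  have hq : 0 < 1 - p := by linarith
  have hD : 0 < M * p * (1 - p) := by positivity
  set D := M * p * (1 - p) with hDdef
  have hw := binomWeight_nonneg (M := M) h0.le h1.le j
  set K := ⌊√(D / 2)⌋₊ with hK
  have hK1 : √(D / 2) < K + 1 := Nat.lt_floor_add_one _
  have hK2 : (K : ℝ) ≤ √(D / 2) := Nat.floor_le (Real.sqrt_nonneg _)
  have hsum : ∑ s ∈ Finset.range (K + 1), binomWeight M p j * (1 / 2)
      ≤ 1 := by
    calc ∑ s ∈ Finset.range (K + 1), binomWeight M p j * (1 / 2)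
        ≤ ∑ s ∈ Finset.range (K + 1), binomWeight M p (j + s) := by
          refine Finset.sum_le_sum fun s hs => ?_
          refine le_trans ?_ (binomWeight_add_ge hM h0 h1 hj s)
          apply mul_le_mul_of_nonneg_left _ hw
          have hsK : (s : ℝ) ≤ √(D / 2) := by
            refine le_trans ?_ hK2
            exact_mod_cast Nat.lt_succ_iff.mp (Finset.mem_range.mp hs)
          have : (s : ℝ) ^ 2 ≤ D / 2 := by
            calc (s : ℝ) ^ 2 ≤ √(D / 2) ^ 2 := by gcongr
              _ = D / 2 := Real.sq_sqrt (by positivity)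
          have : (s : ℝ) ^ 2 / D ≤ 1 / 2 := by
            rw [div_le_iff₀ hD]
            linarith
          linarith
      _ = ∑ i ∈ (Finset.range (K + 1)).map (addLeftEmbedding j), binomWeight M p i := by
          simp
      _ ≤ ∑ i ∈ (Finset.range (K + 1)).map (addLeftEmbedding j) ∪ Finset.range (M + 1),
            binomWeight M p i :=
          Finset.sum_le_sum_of_subset_of_nonneg Finset.subset_union_left fun i _ _ =>
            binomWeight_nonneg h0.le h1.le i
      _ = ∑ i ∈ Finset.range (M + 1), binomWeight M p i := by
          symm
          refine Finset.sum_subset Finset.subset_union_right fun i _ hi => ?_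
          exact binomWeight_eq_zero (by simpa using hi)
      _ = 1 := sum_binomWeight M p
  rw [Finset.sum_const, Finset.card_range, nsmul_eq_mul] at hsum
  push_cast at hsum
  have hsq : √D = √(D / 2) * √2 := by
    rw [← Real.sqrt_mul (by positivity)]
    congr 1
    ring
  have h2 : √2 ≤ 3 / 2 := by
    rw [Real.sqrt_le_left (by norm_num)]
    norm_num
  have hDs : 0 < √D := Real.sqrt_pos.mpr hD
  rw [le_div_iff₀ hDs, hsq]
  have hx : 0 ≤ √(D / 2) := Real.sqrt_nonneg _
  calc binomWeight M p j * (√(D / 2) * √2)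
      ≤ binomWeight M p j * ((K + 1) * (3 / 2)) := by gcongr
    _ ≤ 3 := by linarith

/-- Binomial point masses are of order at most `1 / √M`. -/
lemma binomWeight_le {M : ℕ} {p : ℝ} (hM : 0 < M) (h0 : 0 < p) (h1 : p < 1) (j : ℕ) :
    binomWeight M p j ≤ 3 / √(M * p * (1 - p)) := by
  rcases le_or_gt (j : ℝ) (M * p) with h | h
  · exact binomWeight_le_of_le_mean hM h0 h1 h
  rcases lt_or_ge M j with hj | hj
  · rw [binomWeight_eq_zero hj]
    positivity
  · have hsymm : binomWeight M p j = binomWeight M (1 - p) (M - j) := by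
      unfold binomWeight
      rw [Nat.choose_symm hj, Nat.sub_sub_self hj]
      ring
    have := binomWeight_le_of_le_mean (p := 1 - p) (j := M - j) hM (by linarith) (by linarith)
      (by push_cast [Nat.cast_sub hj]; linarith)
    rw [hsymm]
    convert this using 3
    ring

lemma binomCDF_eq (M : ℕ) (p : ℝ) (k : ℤ) :
    binomCDF M p k = ∑ j ∈ Finset.range (k + 1).toNat, binomWeight M p j := rfl

lemma binomCDF_nonneg {M : ℕ} {p : ℝ} (h0 : 0 ≤ p) (h1 : p ≤ 1) (k : ℤ) : 0 ≤ binomCDF M p k :=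
  Finset.sum_nonneg fun j _ => binomWeight_nonneg h0 h1 j

lemma binomCDF_add_sum_Ico {M : ℕ} {p : ℝ} {k : ℤ} (hk : k ≤ M) :
    binomCDF M p k + ∑ j ∈ Finset.Ico (k + 1).toNat (M + 1), binomWeight M p j = 1 := by
  rw [binomCDF_eq, Finset.sum_range_add_sum_Ico _ (by omega), sum_binomWeight]

lemma binomCDF_le_one {M : ℕ} {p : ℝ} (h0 : 0 ≤ p) (h1 : p ≤ 1) {k : ℤ} (hk : k ≤ M) :
    binomCDF M p k ≤ 1 := by
  have h := binomCDF_add_sum_Ico (M := M) (p := p) hk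
  have : 0 ≤ ∑ j ∈ Finset.Ico (k + 1).toNat (M + 1), binomWeight M p j :=
    Finset.sum_nonneg fun j _ => binomWeight_nonneg h0 h1 j
  linarith

lemma binomCDF_succ (M : ℕ) (p : ℝ) {k : ℤ} (hk : -1 ≤ k) :
    binomCDF M p (k + 1) = binomCDF M p k + binomWeight M p (k + 1).toNat := by
  rw [binomCDF_eq, binomCDF_eq, show (k + 1 + 1).toNat = (k + 1).toNat + 1 by omega,
    Finset.sum_range_succ]

/-- Chebyshev's inequality for the lower tail. -/
lemma binomCDF_le_of_add_le {M : ℕ} {p s : ℝ} (h0 : 0 ≤ p) (h1 : p ≤ 1) (hs : 0 < s) {k : ℤ}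
    (hk : k + s ≤ M * p) : binomCDF M p k ≤ M / (4 * s ^ 2) := by
  rw [binomCDF_eq]
  refine sum_binomWeight_deviation_le h0 h1 hs _ fun j hj => ?_
  have hjk : (j : ℤ) ≤ k := by
    have := Finset.mem_range.mp hj
    omega
  have : (j : ℝ) ≤ k := by exact_mod_cast hjk
  exact le_trans (by linarith) (le_abs_self _)

/-- Chebyshev's inequality for the upper tail. -/
lemma one_sub_binomCDF_le_of_le_sub {M : ℕ} {p s : ℝ} (h0 : 0 ≤ p) (h1 : p ≤ 1) (hs : 0 < s)
    {k : ℤ} (hkM : k ≤ M) (hk : M * p + s ≤ k + 1) :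
    1 - binomCDF M p k ≤ M / (4 * s ^ 2) := by
  rw [← binomCDF_add_sum_Ico (M := M) (p := p) hkM, add_sub_cancel_left]
  refine sum_binomWeight_deviation_le h0 h1 hs _ fun j hj => ?_
  have hjk : k + 1 ≤ (j : ℤ) := by
    have := Finset.mem_Ico.mp hj
    omega
  have : (k : ℝ) + 1 ≤ j := by exact_mod_cast hjk
  rw [abs_sub_comm]
  exact le_trans (by linarith) (le_abs_self _)

/-! ### The cutoff -/

lemma cutoff_mem (M : ℕ) {ε δ : ℝ} (hδ : 0 ≤ δ) :
    cutoff M ε δ ∈ {k : ℤ | -1 ≤ k ∧ k ≤ (M : ℤ) - 1 ∧ binomCDF M ε k ≤ δ} := by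
  refine Int.csSup_mem ⟨-1, by omega, by omega, ?_⟩ ⟨(M : ℤ) - 1, fun k hk => hk.2.1⟩
  simpa [binomCDF] using hδ

/-- Maximality of the cutoff. If the cutoff is `M - 1`, its successor `M` is not a candidate, but
there the distribution function is `1 > δ`. -/
lemma lt_binomCDF_cutoff_add_one (M : ℕ) {ε δ : ℝ} (hδ : δ ∈ Set.Ioo (0 : ℝ) 1) :
    δ < binomCDF M ε (cutoff M ε δ + 1) := by
  obtain ⟨h1, h2, -⟩ := cutoff_mem M (ε := ε) hδ.1.le
  by_contra! hcon
  rcases eq_or_lt_of_le h2 with h | h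
  · rw [h] at hcon
    have := binomCDF_add_sum_Ico (M := M) (p := ε) (k := (M : ℤ) - 1 + 1) (by omega)
    rw [show ((M : ℤ) - 1 + 1 + 1).toNat = M + 1 by omega, Finset.Ico_self, Finset.sum_empty]
      at this
    linarith [hδ.2]
  · have : cutoff M ε δ + 1 ≤ cutoff M ε δ :=
      le_csSup ⟨(M : ℤ) - 1, fun k hk => hk.2.1⟩ ⟨by omega, by omega, hcon⟩
    omega

/-- If the cutoff were lower, Chebyshev's inequality would give at most `δ² / 4 < δ` for the
distribution function at its successor, against maximality. -/
lemma le_cutoff_add_one {M : ℕ} (hM : 0 < M) {ε δ : ℝ} (hε : ε ∈ Set.Ioo (0 : ℝ) 1)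
    (hδ : δ ∈ Set.Ioo (0 : ℝ) 1) : M * ε - √M / δ ≤ cutoff M ε δ + 1 := by
  by_contra! hcon
  have hM' : (0 : ℝ) < M := by exact_mod_cast hM
  have hδ0 := hδ.1
  have hδ1 := hδ.2
  have h := binomCDF_le_of_add_le (M := M) (p := ε) (s := √M / δ) (k := cutoff M ε δ + 1) hε.1.le
    hε.2.le (by positivity) (by push_cast; linarith)
  have h2 := lt_binomCDF_cutoff_add_one M (ε := ε) hδ
  rw [div_pow, Real.sq_sqrt hM'.le] at h
  have : (M : ℝ) / (4 * (M / δ ^ 2)) = δ ^ 2 / 4 := by field_simp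
  rw [this] at h
  nlinarith

lemma cutoff_le {M : ℕ} (hM : 0 < M) {ε δ : ℝ} (hε : ε ∈ Set.Ioo (0 : ℝ) 1)
    (hδ : δ ∈ Set.Ioo (0 : ℝ) 1) : (cutoff M ε δ : ℝ) ≤ M * ε + √M / (1 - δ) := by
  by_contra! hcon
  have hM' : (0 : ℝ) < M := by exact_mod_cast hM
  have hδ0 : 0 < 1 - δ := by linarith [hδ.2]
  have hδ1 := hδ.1
  obtain ⟨h1, h2, h3⟩ := cutoff_mem M (ε := ε) hδ.1.le
  have h := one_sub_binomCDF_le_of_le_sub (M := M) (p := ε) (s := √M / (1 - δ))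
    (k := cutoff M ε δ) hε.1.le hε.2.le (by positivity) (by omega) (by linarith)
  rw [div_pow, Real.sq_sqrt hM'.le] at h
  have : (M : ℝ) / (4 * (M / (1 - δ) ^ 2)) = (1 - δ) ^ 2 / 4 := by field_simp
  rw [this] at h
  nlinarith

/-- Passing from the cutoff to its successor crosses the level `δ` by adding a single point mass, so
the value at the cutoff falls short of `δ` by at most that mass. -/
lemma sub_le_binomCDF_cutoff {M : ℕ} (hM : 0 < M) {ε δ : ℝ} (hε : ε ∈ Set.Ioo (0 : ℝ) 1)
    (hδ : δ ∈ Set.Ioo (0 : ℝ) 1) :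
    δ - 3 / √(ε * (1 - ε)) / √M ≤ binomCDF M ε (cutoff M ε δ) := by
  have h1 := lt_binomCDF_cutoff_add_one M (ε := ε) hδ
  rw [binomCDF_succ _ _ (cutoff_mem M hδ.1.le).1] at h1
  have h2 := binomWeight_le hM hε.1 hε.2 (cutoff M ε δ + 1).toNat
  rw [mul_assoc, Real.sqrt_mul (by positivity), mul_comm, ← div_div] at h2
  linarith

/-- The left side is `(1 / (√M d))²`. The hypotheses give `√M d ≥ 2 c ≥ 1`, so one of the two
factors may be replaced by `2 c`. -/
lemma chebyshev_ratio_le {M : ℕ} (hM : 0 < M) {d c : ℝ} (hd : 0 < d) (hc : 1 / 2 ≤ c)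
    (h : √M * c ≤ M * d / 2) :
    (M : ℝ) / (4 * (M * d / 2) ^ 2) ≤ 2 * c / (√M * d) := by
  have hM' : (0 : ℝ) < √M := by
    rw [Real.sqrt_pos]
    exact_mod_cast hM
  have hMs : (M : ℝ) = √M * √M := (Real.mul_self_sqrt (by positivity)).symm
  set r := √(M : ℝ)
  rw [hMs] at h ⊢
  have h' : c ≤ r * d / 2 := by
    by_contra! hcon
    nlinarith
  have e : r * r / (4 * (r * r * d / 2) ^ 2) = 1 / (r * d) / (r * d) := by
    field_simp
    norm_num
  rw [e]
  have hrd : 0 < r * d := by positivity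
  gcongr
  rw [div_le_iff₀ hrd]
  nlinarith

/-- The cutoff is near `M ε`, hence far above the mean `M α`. If the fluctuation `√M / δ` uses at
most half of the gap `M (ε - α)`, Chebyshev's inequality applies with the other half; otherwise the
claimed bound is at least `1`. -/
lemma one_sub_binomCDF_cutoff_le {M : ℕ} (hM : 0 < M) {ε δ α : ℝ} (hε : ε ∈ Set.Ioo (0 : ℝ) 1)
    (hδ : δ ∈ Set.Ioo (0 : ℝ) 1) (h0 : 0 < α) (hα : α < ε) :
    1 - binomCDF M α (cutoff M ε δ) ≤ 2 / δ / (√M * (ε - α)) := by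
  have hM' : (0 : ℝ) < M := by exact_mod_cast hM
  have hMs : (0 : ℝ) < √M := Real.sqrt_pos.mpr hM'
  have hd : 0 < ε - α := by linarith
  have hα1 : α ≤ 1 := by linarith [hε.2]
  have hδ0 := hδ.1
  rcases le_or_gt (√M * (1 / δ)) (M * (ε - α) / 2) with h | h
  · have hk := le_cutoff_add_one hM hε hδ
    have hkM := (cutoff_mem M (ε := ε) hδ.1.le).2.1
    refine (one_sub_binomCDF_le_of_le_sub (s := M * (ε - α) / 2) h0.le hα1 (by positivity)
      (by omega) ?_).trans ?_
    · rw [div_eq_mul_one_div] at hk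
      linarith
    · have := chebyshev_ratio_le hM hd (c := 1 / δ) ?_ h
      · rwa [mul_one_div] at this
      · rw [le_div_iff₀ hδ0]
        linarith [hδ.2]
  · have h1 := binomCDF_nonneg (M := M) h0.le hα1 (cutoff M ε δ)
    have : 1 ≤ 2 / δ / (√M * (ε - α)) := by
      rw [one_le_div (by positivity)]
      have hMM : (M : ℝ) = √M * √M := (Real.mul_self_sqrt hM'.le).symm
      have : √M * (ε - α) / 2 < 1 / δ := by
        by_contra! hcon
        nlinarith
      have e : 2 / δ = 2 * (1 / δ) := by ring
      rw [e]
      linarith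
    linarith

lemma binomCDF_cutoff_le {M : ℕ} (hM : 0 < M) {ε δ α : ℝ} (hε : ε ∈ Set.Ioo (0 : ℝ) 1)
    (hδ : δ ∈ Set.Ioo (0 : ℝ) 1) (h1 : α < 1) (hα : ε < α) :
    binomCDF M α (cutoff M ε δ) ≤ 2 / (1 - δ) / (√M * (α - ε)) := by
  have hM' : (0 : ℝ) < M := by exact_mod_cast hM
  have hMs : (0 : ℝ) < √M := Real.sqrt_pos.mpr hM'
  have hd : 0 < α - ε := by linarith
  have hα0 : 0 ≤ α := by linarith [hε.1]
  have hδ0 : 0 < 1 - δ := by linarith [hδ.2]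
  have hkM := (cutoff_mem M (ε := ε) hδ.1.le).2.1
  rcases le_or_gt (√M * (1 / (1 - δ))) (M * (α - ε) / 2) with h | h
  · have hk := cutoff_le hM hε hδ
    refine (binomCDF_le_of_add_le (s := M * (α - ε) / 2) hα0 h1.le (by positivity) ?_).trans ?_
    · rw [div_eq_mul_one_div] at hk
      linarith
    · have := chebyshev_ratio_le hM hd (c := 1 / (1 - δ)) ?_ h
      · rwa [mul_one_div] at this
      · rw [le_div_iff₀ hδ0]
        linarith [hδ.1]
  · have h1 := binomCDF_le_one (M := M) hα0 h1.le (k := cutoff M ε δ) (by omega)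
    have : 1 ≤ 2 / (1 - δ) / (√M * (α - ε)) := by
      rw [one_le_div (by positivity)]
      have hMM : (M : ℝ) = √M * √M := (Real.mul_self_sqrt hM'.le).symm
      have : √M * (α - ε) / 2 < 1 / (1 - δ) := by
        by_contra! hcon
        nlinarith
      have e : 2 / (1 - δ) = 2 * (1 / (1 - δ)) := by ring
      rw [e]
      linarith
    linarith

/-! ### Counting in i.i.d. samples -/

section Counting

variable {ι Z : Type*} [Fintype ι] [MeasurableSpace Z] (ρ : Measure Z) [IsProbabilityMeasure ρ]

open Classical in
lemma measureReal_pi_filter_eq {E : Set Z} (hE : MeasurableSet E) (J : Finset ι) :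
    (Measure.pi fun _ : ι => ρ).real {y | Finset.univ.filter (fun i => y i ∈ E) = J}
      = ρ.real E ^ J.card * (1 - ρ.real E) ^ (Fintype.card ι - J.card) := by
  have hset : {y : ι → Z | Finset.univ.filter (fun i => y i ∈ E) = J}
      = Set.univ.pi fun i => if i ∈ J then E else Eᶜ := by
    ext y
    simp only [Set.mem_ofPred_eq, Finset.ext_iff, Finset.mem_filter, Finset.mem_univ, true_and,
      Set.mem_univ_pi]
    refine forall_congr' fun i => ?_
    by_cases hi : i ∈ J <;> simp [hi]
  rw [hset, measureReal_def, Measure.pi_pi, ENNReal.toReal_prod]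
  have : ∀ i, (ρ (if i ∈ J then E else Eᶜ)).toReal
      = if i ∈ J then ρ.real E else 1 - ρ.real E := by
    intro i
    split_ifs
    · rfl
    · exact probReal_compl_eq_one_sub hE
  simp only [this]
  rw [Finset.prod_ite, Finset.prod_const, Finset.prod_const, Finset.filter_mem_eq_inter,
    Finset.univ_inter, Finset.filter_not, Finset.filter_mem_eq_inter, Finset.univ_inter,
    ← Finset.compl_eq_univ_sdiff, Finset.card_compl]

lemma sum_finset_card_eq_sum_binomWeight (ι : Type*) [Fintype ι] (p : ℝ) (f : ℕ → ℝ) :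
    ∑ J : Finset ι, p ^ J.card * (1 - p) ^ (Fintype.card ι - J.card) * f J.card
      = ∑ j ∈ Finset.range (Fintype.card ι + 1), binomWeight (Fintype.card ι) p j * f j := by
  rw [← Finset.powerset_univ,
    Finset.sum_powerset_apply_card
      (fun m => p ^ m * (1 - p) ^ (Fintype.card ι - m) * f m), Finset.card_univ]
  refine Finset.sum_congr rfl fun j _ => ?_
  rw [nsmul_eq_mul, binomWeight]
  ring

open Classical in
lemma measurableSet_filter_eq {E : Set Z} (hE : MeasurableSet E) (J : Finset ι) :
    MeasurableSet {y : ι → Z | Finset.univ.filter (fun i => y i ∈ E) = J} := by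
  simp only [Finset.ext_iff, Finset.mem_filter, Finset.mem_univ, true_and, Set.ofPred_forall]
  refine MeasurableSet.iInter fun i => ?_
  by_cases hi : i ∈ J
  · simp only [hi, iff_true]
    exact (measurable_pi_apply (X := fun _ : ι => Z) i) hE
  · simp only [hi, iff_false]
    exact ((measurable_pi_apply (X := fun _ : ι => Z) i) hE).compl

open Classical in
/-- The number of sample points in `E` is binomially distributed. -/
lemma measureReal_pi_card_filter {E : Set Z} (hE : MeasurableSet E) (φ : ℕ → Prop) :
    (Measure.pi fun _ : ι => ρ).real {y | φ (Finset.univ.filter fun i => y i ∈ E).card}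
      = ∑ j ∈ Finset.range (Fintype.card ι + 1),
          binomWeight (Fintype.card ι) (ρ.real E) j * if φ j then 1 else 0 := by
  have hset : {y : ι → Z | φ (Finset.univ.filter fun i => y i ∈ E).card}
      = ⋃ J ∈ (Finset.univ : Finset (Finset ι)).filter (fun J => φ J.card),
          {y | Finset.univ.filter (fun i => y i ∈ E) = J} := by
    ext y
    simp
  rw [hset, measureReal_biUnion_finset]
  · simp only [measureReal_pi_filter_eq ρ hE]
    rw [← sum_finset_card_eq_sum_binomWeight, Finset.sum_filter]
    refine Finset.sum_congr rfl fun J _ => ?_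
    simp
  · intro J _ J' _ hne
    rw [Function.onFun, Set.disjoint_left]
    rintro y (rfl : _ = J) (rfl : _ = J')
    exact hne rfl
  · exact fun J _ => measurableSet_filter_eq hE J

/-- If an i.i.d. sample has no ties, its marginal has no atoms. -/
lemma nullSingletonClass_map_of_ae_injective {τ : Z → ℝ} (hτ : Measurable τ) {i j : ι} (hij : i ≠ j)
    (h : ∀ᵐ y ∂(Measure.pi fun _ : ι => ρ), Function.Injective fun i => τ (y i)) :
    NullSingletonClass (ρ.map τ) := by
  classical
  refine ⟨fun c => ?_⟩
  rw [Measure.map_apply hτ (measurableSet_singleton c)]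
  -- An atom at `c` would let the coordinates `i` and `j` both score `c` with positive probability,
  -- which is a tie.
  have hnull : (Measure.pi fun _ : ι => ρ)
      (Set.univ.pi fun l => if l = i ∨ l = j then τ ⁻¹' {c} else Set.univ) = 0 := by
    refine measure_mono_null (fun y hy => ?_) (ae_iff.mp h)
    simp only [Set.mem_univ_pi] at hy
    have h1 : τ (y i) = c := by simpa using hy i
    have h2 : τ (y j) = c := by simpa using hy j
    intro hinj
    exact hij (hinj (h1.trans h2.symm))
  rw [Measure.pi_pi, Finset.prod_eq_zero_iff] at hnull
  obtain ⟨l, -, hl⟩ := hnull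
  split_ifs at hl
  · exact hl
  · simp at hl

end Counting

/-! ### Quantiles of laws without atoms -/

/-- Without atoms the distribution function is continuous and attains `1 - α`. The leftmost such
point is needed: on a flat stretch any other choice would break the equivalence with `t < c`. -/
lemma exists_quantile (ρ : Measure ℝ) [IsProbabilityMeasure ρ] [NullSingletonClass ρ] {α : ℝ}
    (hα : α ∈ Set.Ioo (0 : ℝ) 1) :
    ∃ c : ℝ, ρ.real (Set.Ici c) = α ∧ ∀ t : ℝ, α < ρ.real (Set.Ioi t) ↔ t < c := by
  have hcdf : ∀ t, ρ.real (Set.Ioi t) = 1 - cdf ρ t := by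
    intro t
    rw [cdf_eq_real, ← Set.compl_Iic, probReal_compl_eq_one_sub measurableSet_Iic]
  have hcont : Continuous (cdf ρ) := by
    rw [continuous_iff_continuousAt]
    intro x
    rw [(monotone_cdf ρ).continuousAt_iff_leftLim_eq_rightLim, (cdf ρ).rightLim_eq]
    have h := (cdf ρ).measure_singleton x
    rw [measure_cdf, measure_singleton] at h
    have h1 := (monotone_cdf ρ).leftLim_le (le_refl x)
    have h2 := ENNReal.ofReal_eq_zero.mp h.symm
    linarith
  set S := {t : ℝ | 1 - α ≤ cdf ρ t} with hS
  have hclosed : IsClosed S := isClosed_le continuous_const hcont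
  have hne : S.Nonempty := by
    have := (tendsto_cdf_atTop ρ).eventually (eventually_ge_nhds (by linarith [hα.1] : 1 - α < 1))
    exact this.exists
  have hbdd : BddBelow S := by
    obtain ⟨a, ha⟩ := ((tendsto_cdf_atBot ρ).eventually
      (eventually_lt_nhds (by linarith [hα.2] : 0 < 1 - α))).exists
    refine ⟨a, fun t ht => ?_⟩
    by_contra! hta
    have := monotone_cdf ρ hta.le
    have ht' : 1 - α ≤ cdf ρ t := ht
    linarith
  set c := sInf S
  have hc : 1 - α ≤ cdf ρ c := hclosed.csInf_mem hne hbdd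
  have hlt : ∀ t, t < c → cdf ρ t < 1 - α := by
    intro t ht
    by_contra! hcon
    exact absurd (csInf_le hbdd hcon) (not_le.mpr ht)
  have hc' : cdf ρ c ≤ 1 - α := by
    refine le_of_tendsto (x := 𝓝[<] c) (f := cdf ρ) (hcont.continuousAt.mono_left inf_le_left) ?_
    filter_upwards [self_mem_nhdsWithin] with t ht
    exact (hlt t ht).le
  refine ⟨c, ?_, fun t => ?_⟩
  · rw [← measureReal_congr (Ioi_ae_eq_Ici (μ := ρ) (a := c)), hcdf]
    linarith
  · rw [hcdf]
    constructor
    · intro h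
      by_contra! hct
      have := monotone_cdf ρ hct
      linarith
    · intro h
      have := hlt t h
      linarith

/-! ### The threshold -/

/-- In a sorted list the entries below `c` form an initial segment. The default `⊤` is never below
`c`, so indices past the end need no separate hypothesis. -/
lemma getD_lt_iff_lt_countP {l : List EReal} (hl : l.Pairwise (· ≤ ·)) (c : EReal) (m : ℕ) :
    l.getD m ⊤ < c ↔ m < l.countP (· < c) := by
  induction l generalizing m with
  | nil => simp
  | cons a l ih =>
    rw [List.pairwise_cons] at hl
    by_cases hac : a < c
    · cases m with
      | zero => simp [hac]
      | succ m => simpa [hac] using ih hl.2 m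
    · have h0 : l.countP (· < c) = 0 := by
        rw [List.countP_eq_zero]
        intro b hb
        simpa using (not_lt.mp hac).trans (hl.1 b hb)
      cases m with
      | zero => simp [hac, h0]
      | succ m =>
        have := ih hl.2 m
        rw [h0] at this
        simpa [hac, h0] using this

lemma threshold_lt_iff {ι : Type*} (ε δ : ℝ) (I : Finset ι) (τ : ι → ℝ) (c : EReal) :
    threshold ε δ I τ < c ↔ ((I.card : ℤ) - cutoff I.card ε δ - 1).toNat
      < (I.filter fun i => (τ i : EReal) < c).card := by
  rw [threshold, getD_lt_iff_lt_countP (Multiset.pairwise_sort _ _)]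
  have : (((I.val.map fun i => (τ i : EReal)).sort (· ≤ ·)).countP (· < c))
      = (I.filter fun i => (τ i : EReal) < c).card := by
    rw [← Multiset.coe_countP, Multiset.sort_eq, Multiset.countP_map]
    rfl
  rw [this]

lemma threshold_univ_subtype {ι : Type*} (ε δ : ℝ) (I : Finset ι) (τ : ι → ℝ) :
    threshold ε δ (Finset.univ : Finset I) (fun i => τ i) = threshold ε δ I τ := by
  have h := Multiset.attach_map_val' I.val (fun i => (τ i : EReal))
  unfold threshold
  rw [Finset.univ_eq_attach, Finset.card_attach, Finset.attach_val, ← h]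
  rfl

lemma measurable_threshold {ι Z : Type*} [MeasurableSpace Z] (ε δ : ℝ) (I : Finset ι)
    {σ : Z → ι → ℝ} (hσ : ∀ i, Measurable fun z => σ z i) :
    Measurable fun z => threshold ε δ I (σ z) := by
  refine measurable_of_Iio fun c => ?_
  have hcard : Measurable fun z => (I.filter fun i => (σ z i : EReal) < c).card := by
    simp only [Finset.card_filter]
    refine Finset.measurable_sum _ fun i _ => Measurable.ite ?_ measurable_const measurable_const
    exact measurableSet_lt (hσ i).coe_real_ereal measurable_const
  have : (fun z => threshold ε δ I (σ z)) ⁻¹' Set.Iio c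
      = (fun z => (I.filter fun i => (σ z i : EReal) < c).card) ⁻¹'
        Set.Ioi ((I.card : ℤ) - cutoff I.card ε δ - 1).toNat := by
    ext z
    exact threshold_lt_iff ε δ I (σ z) c
  rw [this]
  exact hcard measurableSet_Ioi

lemma notMem_interval_iff {𝒮 : Type*} (qlo qup : 𝒮 → ℝ) {τ : EReal} (hτ : τ ≠ ⊥) (p : 𝒮 × ℝ) :
    p.2 ∉ interval qlo qup τ p.1 ↔ τ < (score qlo qup p : EReal) := by
  rw [← not_le, not_iff_not, interval, Set.mem_ofPred_eq, score]
  induction τ with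
  | bot => exact absurd rfl hτ
  | top => simp
  | coe t =>
    norm_cast
    rw [max_le_iff]
    constructor <;> rintro ⟨h1, h2⟩ <;> constructor <;> linarith

lemma threshold_ne_bot {ι : Type*} (ε δ : ℝ) (I : Finset ι) (τ : ι → ℝ) :
    threshold ε δ I τ ≠ ⊥ := by
  unfold threshold
  set l := (I.val.map fun i => (τ i : EReal)).sort (· ≤ ·) with hl
  set m := ((I.card : ℤ) - cutoff I.card ε δ - 1).toNat
  rcases lt_or_ge m l.length with h | h
  · rw [List.getD_eq_getElem _ _ h]
    have hmem : l[m] ∈ (I.val.map fun i => (τ i : EReal)) := by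
      rw [← Multiset.mem_sort (r := (· ≤ ·))]
      exact List.getElem_mem h
    obtain ⟨i, -, hi⟩ := Multiset.mem_map.mp hmem
    rw [← hi]
    exact EReal.coe_ne_bot _
  · rw [List.getD_eq_default _ _ h]
    exact top_ne_bot

/-- For i.i.d. calibration scores without atoms, the miscoverage `Q {τ > threshold}` is
distributed as an order statistic of uniform variables. -/
lemma measureReal_lt_tail_threshold {κ Z : Type*} [Fintype κ] [MeasurableSpace Z]
    (Q : Measure Z) [IsProbabilityMeasure Q] {τ : Z → ℝ} (hτ : Measurable τ)
    [NullSingletonClass (Q.map τ)]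
    {ε δ α : ℝ} (hδ : 0 ≤ δ) (hα : α ∈ Set.Ioo (0 : ℝ) 1) :
    (Measure.pi fun _ : κ => Q).real
        {y | α < Q.real {p | threshold ε δ Finset.univ (fun i => τ (y i)) < (τ p : EReal)}}
      = binomCDF (Fintype.card κ) α (cutoff (Fintype.card κ) ε δ) := by
  classical
  have := Measure.isProbabilityMeasure_map (μ := Q) hτ.aemeasurable
  obtain ⟨c, hc1, hc2⟩ := exists_quantile (Q.map τ) hα
  -- The quantile `c` replaces a condition on the tail mass by a condition on the threshold alone.
  have htail : ∀ θ : EReal, α < Q.real {p | θ < (τ p : EReal)} ↔ θ < c := by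
    intro θ
    induction θ with
    | bot => simpa using hα.2
    | top => simpa using hα.1.le
    | coe t =>
      rw [EReal.coe_lt_coe_iff, ← hc2 t, map_measureReal_apply hτ measurableSet_Ioi]
      simp [Set.preimage, Set.mem_Ioi]
  obtain ⟨hk1, hk2, -⟩ := cutoff_mem (Fintype.card κ) (ε := ε) hδ
  set M := Fintype.card κ
  set k := cutoff M ε δ
  -- The threshold is below `c` iff more than `M - k - 1` scores are below `c`, that is, iff at most
  -- `k` scores are at least `c`. For `k = -1` both sides are empty.
  have hset : {y : κ → Z |
        α < Q.real {p | threshold ε δ Finset.univ (fun i => τ (y i)) < (τ p : EReal)}}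
      = {y | (Finset.univ.filter fun i => y i ∈ τ ⁻¹' Set.Ici c).card < (k + 1).toNat} := by
    ext y
    rw [Set.mem_ofPred_eq, Set.mem_ofPred_eq, htail, threshold_lt_iff, Finset.card_univ]
    have hsplit := Finset.card_filter_add_card_filter_not (s := (Finset.univ : Finset κ))
      (fun i => y i ∈ τ ⁻¹' Set.Ici c)
    have hfilter : (Finset.univ.filter fun i => ¬ y i ∈ τ ⁻¹' Set.Ici c)
        = Finset.univ.filter fun i => (τ (y i) : EReal) < c := by
      ext i
      simp
    rw [hfilter, Finset.card_univ] at hsplit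
    change ((M : ℤ) - k - 1).toNat < _ ↔ _
    change _ = M at hsplit
    omega
  rw [hset, measureReal_pi_card_filter Q (hτ measurableSet_Ici) (· < (k + 1).toNat),
    ← map_measureReal_apply hτ measurableSet_Ici, hc1, binomCDF_eq]
  simp only [mul_ite, mul_one, mul_zero]
  rw [← Finset.sum_filter]
  refine Finset.sum_congr ?_ fun _ _ => rfl
  ext j
  simp only [Finset.mem_filter, Finset.mem_range]
  change j < M + 1 ∧ _ ↔ _
  omega

/-! ### Miscoverage given an i.i.d. sample from the target law -/

section Sample

variable {𝒮 : Type*} [MeasurableSpace 𝒮] {γ : ℝ} (sp : SplitRule γ) (alg : QuantileAlgorithm 𝒮)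
  (ε δ εlo εup : ℝ) {N : ℕ}

lemma measurable_fitTraining (α : ℝ) :
    Measurable fun q : (Fin N → 𝒮 × ℝ) × 𝒮 => fitTraining sp alg α q.1 q.2 :=
  (alg.measurable_fit α _).comp
    (Measurable.prodMk
      (measurable_pi_lambda _ fun _ => (measurable_pi_apply _).comp measurable_fst)
      measurable_snd)

lemma measurable_score_fitTraining :
    Measurable fun q : (Fin N → 𝒮 × ℝ) × (𝒮 × ℝ) =>
      score (fitTraining sp alg εlo q.1) (fitTraining sp alg εup q.1) q.2 := by
  have h : Measurable fun q : (Fin N → 𝒮 × ℝ) × (𝒮 × ℝ) => (q.1, q.2.1) := by fun_prop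
  have hr : Measurable fun q : (Fin N → 𝒮 × ℝ) × (𝒮 × ℝ) => q.2.2 := by fun_prop
  exact (((measurable_fitTraining sp alg εlo).comp h).sub hr).max
    (hr.sub ((measurable_fitTraining sp alg εup).comp h))

lemma measurable_scores (j : Fin N) :
    Measurable fun z : Fin N → 𝒮 × ℝ => scores sp alg εlo εup z j :=
  (measurable_score_fitTraining sp alg εlo εup).comp
    (measurable_id.prodMk (measurable_pi_apply j))

/-- The fit reads only the training coordinates. This is what lets the calibration scores be i.i.d.
once the training part is fixed. -/
lemma fitTraining_congr (α : ℝ) {z z' : Fin N → 𝒮 × ℝ} (h : ∀ i ∉ sp.calib N, z i = z' i) :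
    fitTraining sp alg α z = fitTraining sp alg α z' := by
  unfold fitTraining
  congr 1
  funext j
  exact h _ (Finset.mem_compl.mp (Finset.orderEmbOfFin_mem _ rfl j))

lemma notMem_calibratedInterval_iff (z : Fin N → 𝒮 × ℝ) (p : 𝒮 × ℝ) :
    p.2 ∉ calibratedInterval sp alg ε δ εlo εup z p.1 ↔
      threshold ε δ (sp.calib N) (scores sp alg εlo εup z)
        < (score (fitTraining sp alg εlo z) (fitTraining sp alg εup z) p : EReal) :=
  notMem_interval_iff _ _ (threshold_ne_bot _ _ _ _) p

lemma measurableSet_notMem_calibratedInterval :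
    MeasurableSet {q : (Fin N → 𝒮 × ℝ) × (𝒮 × ℝ) |
      q.2.2 ∉ calibratedInterval sp alg ε δ εlo εup q.1 q.2.1} := by
  simp only [notMem_calibratedInterval_iff]
  exact measurableSet_lt
    ((measurable_threshold ε δ _ (measurable_scores sp alg εlo εup)).comp measurable_fst)
    (measurable_score_fitTraining sp alg εlo εup).coe_real_ereal

/-- The probability, for a new point with law `Q`, of falling outside the interval computed from
the sample `z`. -/
def sampleMiscoverage (Q : Measure (𝒮 × ℝ)) (z : Fin N → 𝒮 × ℝ) : ℝ :=
  Q.real {p | p.2 ∉ calibratedInterval sp alg ε δ εlo εup z p.1}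

lemma measurable_sampleMiscoverage (Q : Measure (𝒮 × ℝ)) [IsProbabilityMeasure Q] :
    Measurable (sampleMiscoverage sp alg ε δ εlo εup Q (N := N)) :=
  (measurable_measure_prodMk_left
    (measurableSet_notMem_calibratedInterval sp alg ε δ εlo εup)).ennreal_toReal

/-- No ties among the calibration scores of a sample. -/
def SampleNoTies (z : Fin N → 𝒮 × ℝ) : Prop :=
  Set.InjOn (scores sp alg εlo εup z) (sp.calib N : Set (Fin N))

lemma measurableSet_sampleNoTies :
    MeasurableSet {z : Fin N → 𝒮 × ℝ | SampleNoTies sp alg εlo εup z} := by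
  have : {z : Fin N → 𝒮 × ℝ | SampleNoTies sp alg εlo εup z}
      = ⋂ i ∈ sp.calib N, ⋂ j ∈ sp.calib N, ⋂ _ : i ≠ j,
        {z | scores sp alg εlo εup z i = scores sp alg εlo εup z j}ᶜ := by
    ext z
    simp only [SampleNoTies, Set.InjOn, Set.mem_ofPred_eq, Set.mem_iInter, Set.mem_compl_iff,
      Finset.mem_coe]
    exact ⟨fun h i hi j hj hij he => hij (h hi hj he),
      fun h i hi j hj he => by_contra fun hij => h i hi j hj hij he⟩
  rw [this]
  refine Finset.measurableSet_biInter _ fun i _ => Finset.measurableSet_biInter _ fun j _ =>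
    MeasurableSet.iInter fun _ => (measurableSet_eq_fun ?_ ?_).compl
  · exact measurable_scores sp alg εlo εup i
  · exact measurable_scores sp alg εlo εup j

/-- For an i.i.d. sample without ties, the law of the miscoverage is that of an order statistic of
uniform variables. -/
lemma measureReal_lt_sampleMiscoverage (Q : Measure (𝒮 × ℝ)) [IsProbabilityMeasure Q]
    {α : ℝ} (hδ : 0 ≤ δ) (hα : α ∈ Set.Ioo (0 : ℝ) 1) (hcard : 2 ≤ (sp.calib N).card)
    (hties : ∀ᵐ z ∂(Measure.pi fun _ : Fin N => Q), SampleNoTies sp alg εlo εup z) :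
    (Measure.pi fun _ : Fin N => Q).real {z | α < sampleMiscoverage sp alg ε δ εlo εup Q z}
      = binomCDF (sp.calib N).card α (cutoff (sp.calib N).card ε δ) := by
  classical
  obtain ⟨p₀⟩ : Nonempty (𝒮 × ℝ) := nonempty_of_isProbabilityMeasure Q
  set I := sp.calib N with hI
  set e := MeasurableEquiv.piEquivPiSubtypeProd (fun _ : Fin N => 𝒮 × ℝ) (· ∈ I) with he
  have hmp : MeasurePreserving e (Measure.pi fun _ : Fin N => Q)
      ((Measure.pi fun _ : {i // i ∈ I} => Q).prod (Measure.pi fun _ : {i // i ∉ I} => Q)) := by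
    convert measurePreserving_piEquivPiSubtypeProd (fun _ : Fin N => Q) (· ∈ I)
  have hmps := hmp.symm e
  have hesymm1 : ∀ y t (i : Fin N) (hi : i ∈ I), e.symm (y, t) i = y ⟨i, hi⟩ := by
    intro y t i hi
    simp [he, MeasurableEquiv.piEquivPiSubtypeProd, Equiv.piEquivPiSubtypeProd, hi]
  have hesymm2 : ∀ y t (i : Fin N) (hi : i ∉ I), e.symm (y, t) i = t ⟨i, hi⟩ := by
    intro y t i hi
    simp [he, MeasurableEquiv.piEquivPiSubtypeProd, Equiv.piEquivPiSubtypeProd, hi]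
  -- The score function for a fixed training part `t`. The calibration coordinates are filled with
  -- the dummy point `p₀`, which does not affect the fit.
  set τ : ({i // i ∉ I} → 𝒮 × ℝ) → 𝒮 × ℝ → ℝ := fun t =>
    score (fitTraining sp alg εlo (e.symm (fun _ => p₀, t)))
      (fitTraining sp alg εup (e.symm (fun _ => p₀, t))) with hτdef
  have hτ : ∀ t, Measurable (τ t) := fun t =>
    (measurable_score_fitTraining sp alg εlo εup).comp (measurable_const.prodMk measurable_id)
  have hscore : ∀ y t, score (fitTraining sp alg εlo (e.symm (y, t)))
      (fitTraining sp alg εup (e.symm (y, t))) = τ t := by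
    intro y t
    rw [hτdef]
    simp only
    rw [fitTraining_congr sp alg εlo (z' := e.symm (fun _ => p₀, t)),
      fitTraining_congr sp alg εup (z' := e.symm (fun _ => p₀, t))] <;>
    · intro i hi
      rw [hesymm2 _ _ i hi, hesymm2 _ _ i hi]
  have hscores : ∀ y t (i : I), scores sp alg εlo εup (e.symm (y, t)) i = τ t (y i) := by
    intro y t i
    rw [scores, hscore, hesymm1 y t i i.2]
  have hmeas : MeasurableSet {z : Fin N → 𝒮 × ℝ | α < sampleMiscoverage sp alg ε δ εlo εup Q z} :=
    measurable_sampleMiscoverage sp alg ε δ εlo εup Q measurableSet_Ioi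
  have hties' : ∀ᵐ t ∂(Measure.pi fun _ : {i // i ∉ I} => Q),
      ∀ᵐ y ∂(Measure.pi fun _ : {i // i ∈ I} => Q), Function.Injective fun i => τ t (y i) := by
    have h1 := hmps.quasiMeasurePreserving.ae hties
    have h2 := Measure.measurePreserving_swap.quasiMeasurePreserving.ae h1
    filter_upwards [Measure.ae_ae_of_ae_prod h2] with t ht
    filter_upwards [ht] with y hy
    intro i j hij
    simp only at hij
    rw [← hscores y t i, ← hscores y t j] at hij
    exact Subtype.ext (hy i.2 j.2 hij)
  -- Two distinct calibration points are essential: with fewer, absence of ties is vacuous and does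
  -- not exclude atoms.
  obtain ⟨i₀, hi₀, j₀, hj₀, hij⟩ := Finset.one_lt_card.mp (show 1 < I.card by omega)
  -- For almost every training part the conditional probability is the same binomial value, so
  -- integrating over the training part changes nothing.
  have hfiber : ∀ᵐ t ∂(Measure.pi fun _ : {i // i ∉ I} => Q),
      (Measure.pi fun _ : {i // i ∈ I} => Q)
        ((fun y => (y, t)) ⁻¹' (e.symm ⁻¹' {z | α < sampleMiscoverage sp alg ε δ εlo εup Q z}))
      = ENNReal.ofReal (binomCDF I.card α (cutoff I.card ε δ)) := by
    filter_upwards [hties'] with t ht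
    have := nullSingletonClass_map_of_ae_injective Q (hτ t) (i := ⟨i₀, hi₀⟩) (j := ⟨j₀, hj₀⟩)
      (by simpa using hij) ht
    have hmain := measureReal_lt_tail_threshold (κ := {i // i ∈ I}) (ε := ε) Q (hτ t) hδ hα
    rw [Fintype.card_coe] at hmain
    rw [← hmain, ofReal_measureReal]
    congr 1
    ext y
    simp only [Set.mem_preimage, Set.mem_ofPred_eq, sampleMiscoverage,
      notMem_calibratedInterval_iff, hscore]
    rw [← hI, ← threshold_univ_subtype]
    simp only [hscores]
  rw [measureReal_def, ← hmps.measure_preimage hmeas.nullMeasurableSet,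
    Measure.prod_apply_symm (e.symm.measurable hmeas), lintegral_congr_ae hfiber, lintegral_const,
    measure_univ, mul_one, ENNReal.toReal_ofReal (binomCDF_nonneg hα.1.le hα.2.le _)]

end Sample

/-! ### Rejection sampling -/

section Rejection

variable {𝒮 𝒜 : Type*} [MeasurableSpace 𝒮] [MeasurableSpace 𝒜] {ν : Kernel 𝒮 𝒜}
  {πe πb : Policy ν}

/-- The infimum is attained: where `π_b` vanishes, any admissible constant forces `π_e` to vanish;
elsewhere the condition is an upper bound on a fixed ratio and passes to the infimum. -/
lemma ratioBound_mem (h : (dominatingConstants πe πb).Nonempty) :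
    ratioBound πe πb ∈ dominatingConstants πe πb := by
  intro s a
  obtain ⟨b₀, hb₀⟩ := h
  rcases eq_or_lt_of_le (NNReal.coe_nonneg (πb.dens s a)) with h0 | h0
  · have := hb₀ s a
    rw [← h0] at this ⊢
    simpa using this
  · rw [← div_le_iff₀ h0]
    refine le_csInf ⟨b₀, hb₀⟩ fun b hb => ?_
    rw [div_le_iff₀ h0]
    exact hb s a

/-- Integrating `π_e ≤ B π_b` over the actions compares two total masses equal to `1`. -/
lemma one_le_ratioBound [Nonempty 𝒮] (h : (dominatingConstants πe πb).Nonempty) :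
    1 ≤ ratioBound πe πb := by
  obtain ⟨s⟩ := ‹Nonempty 𝒮›
  have hmem := ratioBound_mem h
  have hle : ∫⁻ a, (πe.dens s a : ℝ≥0∞) ∂(ν s)
      ≤ ∫⁻ a, ENNReal.ofReal (ratioBound πe πb) * (πb.dens s a : ℝ≥0∞) ∂(ν s) := by
    refine lintegral_mono fun a => ?_
    rw [← ENNReal.ofReal_coe_nnreal, ← ENNReal.ofReal_coe_nnreal,
      ← ENNReal.ofReal_mul' (NNReal.coe_nonneg _)]
    exact ENNReal.ofReal_le_ofReal (hmem s a)
  rw [lintegral_const_mul' _ _ ENNReal.ofReal_ne_top, πe.lintegral_dens, πb.lintegral_dens,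
    mul_one] at hle
  simpa using hle

lemma weight_nonneg (s : 𝒮) (a : 𝒜) : 0 ≤ weight πe πb s a := by
  unfold weight
  positivity

lemma weight_mul_dens (h : (dominatingConstants πe πb).Nonempty) (s : 𝒮) (a : 𝒜) :
    weight πe πb s a * πb.dens s a = πe.dens s a := by
  unfold weight
  rcases eq_or_ne (πb.dens s a : ℝ) 0 with h0 | h0
  · have := ratioBound_mem h s a
    rw [h0, mul_zero] at this ⊢
    exact le_antisymm (NNReal.coe_nonneg _) this
  · exact div_mul_cancel₀ _ h0

lemma weight_le_ratioBound [Nonempty 𝒮] (h : (dominatingConstants πe πb).Nonempty) (s : 𝒮)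
    (a : 𝒜) : weight πe πb s a ≤ ratioBound πe πb := by
  have h1 := one_le_ratioBound h
  unfold weight
  rcases eq_or_lt_of_le (NNReal.coe_nonneg (πb.dens s a)) with h0 | h0
  · rw [← h0, div_zero]
    linarith
  · rw [div_le_iff₀ h0]
    exact ratioBound_mem h s a

lemma measurable_weight :
    Measurable fun x : (𝒮 × 𝒜) × ℝ => weight πe πb x.1.1 x.1.2 :=
  (πe.measurable_dens.coe_nnreal_real.comp measurable_fst).div
    (πb.measurable_dens.coe_nnreal_real.comp measurable_fst)

/-- The acceptance region of rejection sampling for one observation. -/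
def acceptRegion (πe πb : Policy ν) : Set (((𝒮 × 𝒜) × ℝ) × ℝ) :=
  {y | y.2 ≤ 1 / ratioBound πe πb * weight πe πb y.1.1.1 y.1.1.2}

lemma measurableSet_acceptRegion : MeasurableSet (acceptRegion πe πb) :=
  measurableSet_le measurable_snd ((measurable_weight.comp measurable_fst).const_mul _)

lemma measurable_contextReward : Measurable fun t : (𝒮 × 𝒜) × ℝ => (t.1.1, t.2) := by fun_prop

/-- The pairs `(S, R)` of the observations with indices in `A`, in their original order. -/
def subsample {n : ℕ} (A : Finset (Fin n)) (y : Fin n → ((𝒮 × 𝒜) × ℝ) × ℝ) :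
    Fin A.card → 𝒮 × ℝ :=
  fun j => ((y (A.orderEmbOfFin rfl j)).1.1.1, (y (A.orderEmbOfFin rfl j)).1.2)

lemma measurable_subsample {n : ℕ} (A : Finset (Fin n)) :
    Measurable (subsample (𝒮 := 𝒮) (𝒜 := 𝒜) A) := by
  refine measurable_pi_lambda _ fun j => ?_
  exact measurable_contextReward.comp (measurable_fst.comp (measurable_pi_apply _))

/-- The event that exactly the observations with indices in `A` are accepted. -/
def acceptEvent (πe πb : Policy ν) {n : ℕ} (A : Finset (Fin n)) :
    Set (Fin n → ((𝒮 × 𝒜) × ℝ) × ℝ) :=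
  {y | accepted πe πb (fun i => (y i).1) (fun i => (y i).2) = A}

lemma acceptEvent_eq {n : ℕ} (A : Finset (Fin n)) :
    acceptEvent πe πb A
      = Set.univ.pi fun i => if i ∈ A then acceptRegion πe πb else (acceptRegion πe πb)ᶜ := by
  ext y
  simp only [acceptEvent, accepted, Set.mem_ofPred_eq, Finset.ext_iff, Finset.mem_filter,
    Finset.mem_univ, true_and, Set.mem_univ_pi]
  refine forall_congr' fun i => ?_
  by_cases hi : i ∈ A <;> simp [hi, acceptRegion]

lemma measurableSet_acceptEvent {n : ℕ} (A : Finset (Fin n)) :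
    MeasurableSet (acceptEvent πe πb A) := by
  rw [acceptEvent_eq]
  refine MeasurableSet.univ_pi fun i => ?_
  split_ifs
  · exact measurableSet_acceptRegion
  · exact measurableSet_acceptRegion.compl

/-- The size, hence the type, of the kept sample is random. Splitting by the set `A` of kept indices
reduces everything to samples of fixed size. -/
lemma setOf_rsSample_mem_eq {n : ℕ} (Φ : ∀ N : ℕ, Set (Fin N → 𝒮 × ℝ)) :
    {y : Fin n → ((𝒮 × 𝒜) × ℝ) × ℝ |
        rsSample πe πb (fun i => (y i).1) (fun i => (y i).2) ∈ Φ _}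
      = ⋃ A ∈ (Finset.univ : Finset (Finset (Fin n))),
          subsample A ⁻¹' Φ A.card ∩ acceptEvent πe πb A := by
  ext y
  simp only [Set.mem_ofPred_eq, Finset.mem_univ, Set.iUnion_true, Set.mem_iUnion,
    Set.mem_inter_iff, Set.mem_preimage]
  constructor
  · intro hy
    exact ⟨_, hy, rfl⟩
  · rintro ⟨A, hA, rfl⟩
    exact hA

variable [IsSFiniteKernel ν]

instance isProbabilityMeasure_jointLaw (PS : Measure 𝒮) [IsProbabilityMeasure PS]
    (PR : Kernel (𝒮 × 𝒜) ℝ) [IsMarkovKernel PR] (π : Policy ν) :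
    IsProbabilityMeasure (jointLaw PS PR π) := by
  unfold jointLaw
  infer_instance

variable (PS : Measure 𝒮) [IsProbabilityMeasure PS] (PR : Kernel (𝒮 × 𝒜) ℝ) [IsMarkovKernel PR]

lemma lintegral_jointLaw (π : Policy ν) {f : (𝒮 × 𝒜) × ℝ → ℝ≥0∞} (hf : Measurable f) :
    ∫⁻ t, f t ∂(jointLaw PS PR π)
      = ∫⁻ s, ∫⁻ a, (π.dens s a : ℝ≥0∞) * ∫⁻ r, f ((s, a), r) ∂(PR (s, a)) ∂(ν s) ∂PS := by
  have hd : Measurable (Function.uncurry fun s a => (π.dens s a : ℝ≥0∞)) :=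
    π.measurable_dens.coe_nnreal_ennreal
  have hg : Measurable fun x : 𝒮 × 𝒜 => ∫⁻ r, f (x, r) ∂(PR x) := hf.lintegral_kernel_prod_right'
  rw [jointLaw, Measure.lintegral_compProd hf, Measure.lintegral_compProd hg]
  refine lintegral_congr fun s => ?_
  rw [Policy.kernel, Kernel.withDensity_apply _ hd,
    lintegral_withDensity_eq_lintegral_mul _ (f := fun a => (π.dens s a : ℝ≥0∞))
      (hd.comp measurable_prodMk_left)
      (g := fun a => ∫⁻ r, f ((s, a), r) ∂(PR (s, a))) (hg.comp measurable_prodMk_left)]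
  rfl

/-- Importance weighting turns the behavior law into the target law. -/
lemma setLIntegral_weight_jointLaw (h : (dominatingConstants πe πb).Nonempty)
    {E : Set ((𝒮 × 𝒜) × ℝ)} (hE : MeasurableSet E) :
    ∫⁻ t in E, ENNReal.ofReal (weight πe πb t.1.1 t.1.2) ∂(jointLaw PS PR πb)
      = jointLaw PS PR πe E := by
  rw [← lintegral_indicator hE, ← lintegral_indicator_one hE,
    lintegral_jointLaw _ _ _ (measurable_weight.ennreal_ofReal.indicator hE),
    lintegral_jointLaw _ _ _ (measurable_one.indicator hE)]
  refine lintegral_congr fun s => lintegral_congr fun a => ?_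
  have : ∀ r : ℝ, E.indicator
      (fun t => ENNReal.ofReal (weight πe πb t.1.1 t.1.2)) ((s, a), r)
      = ENNReal.ofReal (weight πe πb s a) * E.indicator 1 ((s, a), r) := by
    intro r
    by_cases hr : ((s, a), r) ∈ E <;> simp [hr]
  simp only [this]
  rw [lintegral_const_mul' _ _ ENNReal.ofReal_ne_top, ← mul_assoc]
  congr 1
  rw [← ENNReal.ofReal_coe_nnreal, ← ENNReal.ofReal_coe_nnreal, mul_comm,
    ← ENNReal.ofReal_mul (weight_nonneg s a), weight_mul_dens h]

/-- The law of one observation together with its uniform variable. -/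
def proposalLaw (πb : Policy ν) : Measure (((𝒮 × 𝒜) × ℝ) × ℝ) :=
  (jointLaw PS PR πb).prod (volume.restrict (Set.Icc (0 : ℝ) 1))

instance isProbabilityMeasure_uniform :
    IsProbabilityMeasure ((volume : Measure ℝ).restrict (Set.Icc (0 : ℝ) 1)) :=
  ⟨by simp⟩

instance isProbabilityMeasure_proposalLaw : IsProbabilityMeasure (proposalLaw PS PR πb) := by
  unfold proposalLaw
  infer_instance

/-- Given the observation, a uniform variable accepts with probability `w / B`, which lies in `[0,
1]`. Integrating the weight over `E` against the behavior law gives the target law of `E`. -/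
lemma proposalLaw_accept_inter (h : (dominatingConstants πe πb).Nonempty)
    {E : Set ((𝒮 × 𝒜) × ℝ)} (hE : MeasurableSet E) :
    proposalLaw PS PR πb (acceptRegion πe πb ∩ Prod.fst ⁻¹' E)
      = ENNReal.ofReal (1 / ratioBound πe πb) * jointLaw PS PR πe E := by
  have : Nonempty 𝒮 := nonempty_of_isProbabilityMeasure PS
  have hB := one_le_ratioBound h
  rw [proposalLaw, Measure.prod_apply (measurableSet_acceptRegion.inter (measurable_fst hE)),
    ← setLIntegral_weight_jointLaw PS PR h hE, ← lintegral_const_mul' _ _ ENNReal.ofReal_ne_top,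
    ← lintegral_indicator hE]
  refine lintegral_congr fun x => ?_
  by_cases hx : x ∈ E
  · rw [Set.indicator_of_mem hx, ← ENNReal.ofReal_mul (by positivity)]
    set c := 1 / ratioBound πe πb * weight πe πb x.1.1 x.1.2 with hc
    have hc0 : 0 ≤ c := mul_nonneg (by positivity) (weight_nonneg _ _)
    have hc1 : c ≤ 1 := by
      rw [hc, one_div, inv_mul_le_iff₀ (by linarith), mul_one]
      exact weight_le_ratioBound h _ _
    have hpre : Prod.mk x ⁻¹' (acceptRegion πe πb ∩ Prod.fst ⁻¹' E) = Set.Iic c := by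
      ext v
      simp [acceptRegion, hx, hc]
    rw [hpre, Measure.restrict_apply measurableSet_Iic]
    have : Set.Iic c ∩ Set.Icc 0 1 = Set.Icc 0 c := by
      ext v
      simp only [Set.mem_inter_iff, Set.mem_Iic, Set.mem_Icc]
      constructor
      · rintro ⟨h1, h2, h3⟩
        exact ⟨h2, h1⟩
      · rintro ⟨h1, h2⟩
        exact ⟨h2, h1, h2.trans hc1⟩
    rw [this, Real.volume_Icc, sub_zero]
  · rw [Set.indicator_of_notMem hx]
    have hpre : Prod.mk x ⁻¹' (acceptRegion πe πb ∩ Prod.fst ⁻¹' E) = ∅ := by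
      ext v
      simp [hx]
    rw [hpre, measure_empty]

lemma proposalLaw_accept_compl (h : (dominatingConstants πe πb).Nonempty) :
    proposalLaw PS PR πb (acceptRegion πe πb)ᶜ
      = ENNReal.ofReal (1 - 1 / ratioBound πe πb) := by
  have : Nonempty 𝒮 := nonempty_of_isProbabilityMeasure PS
  have hB := one_le_ratioBound h
  have h1 := proposalLaw_accept_inter PS PR h MeasurableSet.univ
  rw [Set.preimage_univ, Set.inter_univ, measure_univ, mul_one] at h1
  rw [prob_compl_eq_one_sub measurableSet_acceptRegion, h1, ENNReal.ofReal_sub _ (by positivity),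
    ENNReal.ofReal_one]

/-- The law of the pair `(S, R)` under the target policy. -/
def targetLaw (πe : Policy ν) : Measure (𝒮 × ℝ) :=
  (jointLaw PS PR πe).map fun t => (t.1.1, t.2)

instance isProbabilityMeasure_targetLaw : IsProbabilityMeasure (targetLaw PS PR πe) :=
  Measure.isProbabilityMeasure_map measurable_contextReward.aemeasurable

/-- The event is itself a box in the original coordinates: an accepted index contributes `1/B` times
a target probability, a rejected one `1 - 1/B`. -/
lemma pi_proposalLaw_accept_box (h : (dominatingConstants πe πb).Nonempty) {n : ℕ}
    (A : Finset (Fin n)) {F : Fin A.card → Set (𝒮 × ℝ)} (hF : ∀ j, MeasurableSet (F j)) :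
    (Measure.pi fun _ : Fin n => proposalLaw PS PR πb)
        (subsample A ⁻¹' (Set.univ.pi F) ∩ acceptEvent πe πb A)
      = ENNReal.ofReal (1 / ratioBound πe πb) ^ A.card
          * ENNReal.ofReal (1 - 1 / ratioBound πe πb) ^ (n - A.card)
          * ∏ j, targetLaw PS PR πe (F j) := by
  set σ : Fin A.card ≃ {i // i ∈ A} := (A.orderIsoOfFin rfl).toEquiv with hσ
  have hσval : ∀ j, ((σ j : {i // i ∈ A}) : Fin n) = A.orderEmbOfFin rfl j := fun j => rfl
  set G : Fin A.card → Set (((𝒮 × 𝒜) × ℝ) × ℝ) := fun j =>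
    Prod.fst ⁻¹' ((fun t => (t.1.1, t.2)) ⁻¹' F j) with hG
  have hset : subsample A ⁻¹' (Set.univ.pi F) ∩ acceptEvent πe πb A
      = Set.univ.pi fun i => if hi : i ∈ A then acceptRegion πe πb ∩ G (σ.symm ⟨i, hi⟩)
          else (acceptRegion πe πb)ᶜ := by
    ext y
    rw [acceptEvent_eq]
    simp only [Set.mem_inter_iff, Set.mem_preimage, Set.mem_univ_pi]
    constructor
    · rintro ⟨h1, h2⟩ i
      have h2i := h2 i
      by_cases hi : i ∈ A
      · simp only [hi, if_true, dif_pos] at h2i ⊢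
        refine ⟨h2i, ?_⟩
        have := h1 (σ.symm ⟨i, hi⟩)
        simp only [subsample, ← hσval, Equiv.apply_symm_apply] at this
        exact this
      · simpa [hi] using h2i
    · intro hy
      refine ⟨fun j => ?_, fun i => ?_⟩
      · have := hy (σ j)
        rw [dif_pos (σ j).2] at this
        have h3 := this.2
        simp only [Subtype.coe_eta, Equiv.symm_apply_apply] at h3
        exact h3
      · have := hy i
        by_cases hi : i ∈ A
        · simp only [hi, if_true, dif_pos] at this ⊢
          exact this.1
        · simpa [hi] using this
  rw [hset, Measure.pi_pi, ← Fintype.prod_subtype_mul_prod_subtype (fun i => i ∈ A)]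
  have h1 : ∏ i : {i // i ∈ A}, proposalLaw PS PR πb
      (if hi : (i : Fin n) ∈ A then acceptRegion πe πb ∩ G (σ.symm ⟨i, hi⟩)
          else (acceptRegion πe πb)ᶜ)
      = ENNReal.ofReal (1 / ratioBound πe πb) ^ A.card * ∏ j, targetLaw PS PR πe (F j) := by
    rw [← Fintype.prod_equiv σ (fun j => ENNReal.ofReal (1 / ratioBound πe πb)
      * targetLaw PS PR πe (F j)), Finset.prod_mul_distrib, Finset.prod_const, Finset.card_univ,
      Fintype.card_fin]
    intro j
    rw [dif_pos (σ j).2, Subtype.coe_eta, Equiv.symm_apply_apply, hG,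
      proposalLaw_accept_inter PS PR h (measurable_contextReward (hF j)), targetLaw,
      Measure.map_apply measurable_contextReward (hF j)]
  have h2 : ∏ i : {i // i ∉ A}, proposalLaw PS PR πb
      (if hi : (i : Fin n) ∈ A then acceptRegion πe πb ∩ G (σ.symm ⟨i, hi⟩)
          else (acceptRegion πe πb)ᶜ)
      = ENNReal.ofReal (1 - 1 / ratioBound πe πb) ^ (n - A.card) := by
    have : ∀ i : {i // i ∉ A}, proposalLaw PS PR πb
      (if hi : (i : Fin n) ∈ A then acceptRegion πe πb ∩ G (σ.symm ⟨i, hi⟩)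
          else (acceptRegion πe πb)ᶜ) = ENNReal.ofReal (1 - 1 / ratioBound πe πb) := by
      intro i
      rw [dif_neg i.2, proposalLaw_accept_compl PS PR h]
    simp only [this]
    rw [Finset.prod_const, Finset.card_univ, Fintype.card_subtype_compl, Fintype.card_fin,
      Fintype.card_coe]
  rw [mul_right_comm]
  convert congrArg₂ (· * ·) h1 h2

/-- Given the accepted indices, the accepted pairs are i.i.d. with the target law. -/
lemma map_subsample_restrict_acceptEvent (h : (dominatingConstants πe πb).Nonempty) {n : ℕ}
    (A : Finset (Fin n)) :
    ((Measure.pi fun _ : Fin n => proposalLaw PS PR πb).restrict (acceptEvent πe πb A)).map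
        (subsample A)
      = (ENNReal.ofReal (1 / ratioBound πe πb) ^ A.card
          * ENNReal.ofReal (1 - 1 / ratioBound πe πb) ^ (n - A.card))
        • Measure.pi fun _ : Fin A.card => targetLaw PS PR πe := by
  set c := ENNReal.ofReal (1 / ratioBound πe πb) ^ A.card
          * ENNReal.ofReal (1 - 1 / ratioBound πe πb) ^ (n - A.card) with hc
  set η := ((Measure.pi fun _ : Fin n => proposalLaw PS PR πb).restrict
    (acceptEvent πe πb A)).map (subsample A) with hη
  have hbox : ∀ F : Fin A.card → Set (𝒮 × ℝ), (∀ j, MeasurableSet (F j)) →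
      η (Set.univ.pi F) = c * ∏ j, targetLaw PS PR πe (F j) := by
    intro F hF
    rw [hη, Measure.map_apply (measurable_subsample A) (MeasurableSet.univ_pi hF),
      Measure.restrict_apply (measurable_subsample A (MeasurableSet.univ_pi hF)),
      pi_proposalLaw_accept_box PS PR h A hF]
  have hctop : c ≠ ∞ := by
    rw [hc]
    exact ENNReal.mul_ne_top (ENNReal.pow_ne_top ENNReal.ofReal_ne_top)
      (ENNReal.pow_ne_top ENNReal.ofReal_ne_top)
  -- The factor `c` vanishes when `B = 1` and some index is rejected; both measures are then zero.
  -- Otherwise dividing by `c` permits the uniqueness of product measures.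
  rcases eq_or_ne c 0 with h0 | h0
  · have := hbox (fun _ => Set.univ) fun _ => MeasurableSet.univ
    rw [Set.pi_univ, h0, zero_mul, Measure.measure_univ_eq_zero] at this
    rw [this, h0, zero_smul]
  · have : (Measure.pi fun _ : Fin A.card => targetLaw PS PR πe) = c⁻¹ • η := by
      refine Measure.pi_eq fun F hF => ?_
      rw [Measure.smul_apply, hbox F hF, smul_eq_mul, ← mul_assoc, ENNReal.inv_mul_cancel h0 hctop,
        one_mul]
    rw [this, smul_smul, ENNReal.mul_inv_cancel h0 hctop, one_smul]

end Rejection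

/-! ### The law of the accepted sample -/

section Experiment

lemma IsExperiment.measurable_proposals {𝒮 𝒜 Ω : Type*} [MeasurableSpace 𝒮] [MeasurableSpace 𝒜]
    [MeasurableSpace Ω] {ν : Kernel 𝒮 𝒜} [IsSFiniteKernel ν] {P : Measure Ω} {PS : Measure 𝒮}
    {PR : Kernel (𝒮 × 𝒜) ℝ} {πe πb : Policy ν} {X : ℕ → Ω → (𝒮 × 𝒜) × ℝ} {V : ℕ → Ω → ℝ}
    {T : Ω → (𝒮 × 𝒜) × ℝ} (hexp : IsExperiment P PS PR πe πb X V T) (n : ℕ) :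
    Measurable (fun ω (i : Fin n) => (X i ω, V i ω)) :=
  measurable_pi_lambda _ fun i => (hexp.measurable_X i).prodMk (hexp.measurable_V i)

variable {𝒮 𝒜 Ω : Type*} [MeasurableSpace 𝒮] [MeasurableSpace 𝒜] [MeasurableSpace Ω]
  {ν : Kernel 𝒮 𝒜} [IsSFiniteKernel ν] {P : Measure Ω} [IsProbabilityMeasure P]
  {PS : Measure 𝒮} [IsProbabilityMeasure PS] {PR : Kernel (𝒮 × 𝒜) ℝ} [IsMarkovKernel PR]
  {πe πb : Policy ν} {X : ℕ → Ω → (𝒮 × 𝒜) × ℝ} {V : ℕ → Ω → ℝ} {T : Ω → (𝒮 × 𝒜) × ℝ}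

lemma IsExperiment.map_proposals (hexp : IsExperiment P PS PR πe πb X V T) (n : ℕ) :
    P.map (fun ω (i : Fin n) => (X i ω, V i ω))
      = Measure.pi fun _ : Fin n => proposalLaw PS PR πb := by
  have hX : P.map (fun ω (i : Fin n) => X i ω)
      = Measure.pi fun _ : Fin n => jointLaw PS PR πb := by
    have := (iIndepFun_iff_map_fun_eq_pi_map fun i : Fin n => (hexp.measurable_X i).aemeasurable).mp
      (hexp.iIndepFun_X.precomp Fin.val_injective)
    rw [this]
    simp only [hexp.law_X]
  have hV : P.map (fun ω (i : Fin n) => V i ω)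
      = Measure.pi fun _ : Fin n => volume.restrict (Set.Icc (0 : ℝ) 1) := by
    have := (iIndepFun_iff_map_fun_eq_pi_map fun i : Fin n => (hexp.measurable_V i).aemeasurable).mp
      (hexp.iIndepFun_V.precomp Fin.val_injective)
    rw [this]
    simp only [hexp.law_V]
  have hmX : Measurable fun ω (i : Fin n) => X i ω :=
    measurable_pi_lambda _ fun i => hexp.measurable_X i
  have hmV : Measurable fun ω (i : Fin n) => V i ω :=
    measurable_pi_lambda _ fun i => hexp.measurable_V i
  have hind : IndepFun (fun ω (i : Fin n) => X i ω) (fun ω (i : Fin n) => V i ω) P :=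
    hexp.indepFun_X_V.comp (φ := fun x (i : Fin n) => x i) (ψ := fun v (i : Fin n) => v i)
      (measurable_pi_lambda _ fun i => measurable_pi_apply _)
      (measurable_pi_lambda _ fun i => measurable_pi_apply _)
  have hXV := (indepFun_iff_map_prod_eq_prod_map_map hmX.aemeasurable hmV.aemeasurable).mp hind
  rw [hX, hV] at hXV
  have hmp := (measurePreserving_arrowProdEquivProdArrow ((𝒮 × 𝒜) × ℝ) ℝ (Fin n)
    (fun _ => jointLaw PS PR πb) (fun _ => volume.restrict (Set.Icc (0 : ℝ) 1))).symm
  have := hmp.map_eq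
  rw [← hXV, Measure.map_map (MeasurableEquiv.measurable _) (hmX.prodMk hmV)] at this
  exact this

/-- The law of the accepted sample: a mixture, with binomial weights, of i.i.d. samples from the
target law. -/
lemma IsExperiment.measureReal_rsSample_mem (hexp : IsExperiment P PS PR πe πb X V T)
    (h : (dominatingConstants πe πb).Nonempty) (n : ℕ) {Φ : ∀ N : ℕ, Set (Fin N → 𝒮 × ℝ)}
    (hΦ : ∀ N, MeasurableSet (Φ N)) :
    P.real {ω | rsSample πe πb (fun i : Fin n => X i ω) (fun i : Fin n => V i ω) ∈ Φ _}
      = ∑ N ∈ Finset.range (n + 1), binomWeight n (1 / ratioBound πe πb) N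
          * (Measure.pi fun _ : Fin N => targetLaw PS PR πe).real (Φ N) := by
  have : Nonempty 𝒮 := nonempty_of_isProbabilityMeasure PS
  have hB := one_le_ratioBound h
  have hB1 : 1 / ratioBound πe πb ≤ 1 := by
    rw [div_le_one (by linarith)]
    exact hB
  have hmeas : ∀ A : Finset (Fin n),
      MeasurableSet (subsample A ⁻¹' Φ A.card ∩ acceptEvent πe πb A) := fun A =>
    (measurable_subsample A (hΦ _)).inter (measurableSet_acceptEvent A)
  have hset := setOf_rsSample_mem_eq (n := n) (πe := πe) (πb := πb) Φ
  have hpre : P.real {ω | rsSample πe πb (fun i : Fin n => X i ω) (fun i : Fin n => V i ω) ∈ Φ _}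
      = (Measure.pi fun _ : Fin n => proposalLaw PS PR πb).real
        {y | rsSample πe πb (fun i => (y i).1) (fun i => (y i).2) ∈ Φ _} := by
    rw [← hexp.map_proposals n, map_measureReal_apply (hexp.measurable_proposals n)]
    · rfl
    · rw [hset]
      exact Finset.measurableSet_biUnion _ fun A _ => hmeas A
  rw [hpre, hset, measureReal_biUnion_finset]
  · have hA : ∀ A : Finset (Fin n), (Measure.pi fun _ : Fin n => proposalLaw PS PR πb).real
        (subsample A ⁻¹' Φ A.card ∩ acceptEvent πe πb A)
        = (1 / ratioBound πe πb) ^ A.card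
          * (1 - 1 / ratioBound πe πb) ^ (Fintype.card (Fin n) - A.card)
          * (Measure.pi fun _ : Fin A.card => targetLaw PS PR πe).real (Φ A.card) := by
      intro A
      have := congrArg (fun μ : Measure (Fin A.card → 𝒮 × ℝ) => μ (Φ A.card))
        (map_subsample_restrict_acceptEvent PS PR h A)
      rw [Measure.map_apply (measurable_subsample A) (hΦ _),
        Measure.restrict_apply (measurable_subsample A (hΦ _))] at this
      rw [measureReal_def, this, Measure.smul_apply, smul_eq_mul, ENNReal.toReal_mul,
        ENNReal.toReal_mul, ENNReal.toReal_pow, ENNReal.toReal_pow,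
        ENNReal.toReal_ofReal (by positivity), ENNReal.toReal_ofReal (by linarith),
        Fintype.card_fin]
      rfl
    simp only [hA]
    rw [sum_finset_card_eq_sum_binomWeight (Fin n) (1 / ratioBound πe πb)
      (fun N => (Measure.pi fun _ : Fin N => targetLaw PS PR πe).real (Φ N)), Fintype.card_fin]
  · intro A _ A' _ hne
    rw [Function.onFun, Set.disjoint_left]
    rintro y ⟨-, hy : _ = A⟩ ⟨-, hy' : _ = A'⟩
    exact hne (hy.symm.trans hy')
  · exact fun A _ => hmeas A

/-- If the algorithm almost surely meets no ties, an i.i.d. sample from the target law has none. -/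
lemma IsExperiment.ae_sampleNoTies (hexp : IsExperiment P PS PR πe πb X V T)
    (h : (dominatingConstants πe πb).Nonempty) {γ : ℝ} (sp : SplitRule γ)
    (alg : QuantileAlgorithm 𝒮) (εlo εup : ℝ) (N : ℕ)
    (hties : ∀ᵐ ω ∂P, NoTies πe πb sp alg εlo εup
      (fun i : Fin N => X i ω) (fun i : Fin N => V i ω)) :
    ∀ᵐ z ∂(Measure.pi fun _ : Fin N => targetLaw PS PR πe), SampleNoTies sp alg εlo εup z := by
  have : Nonempty 𝒮 := nonempty_of_isProbabilityMeasure PS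
  have hB := one_le_ratioBound h
  have hB1 : 1 / ratioBound πe πb ≤ 1 := by
    rw [div_le_one (by linarith)]
    exact hB
  have hmix := hexp.measureReal_rsSample_mem h N
    (Φ := fun N => {z | SampleNoTies sp alg εlo εup z}ᶜ)
    fun N => (measurableSet_sampleNoTies sp alg εlo εup).compl
  have hzero : P.real {ω | rsSample πe πb (fun i : Fin N => X i ω) (fun i : Fin N => V i ω)
      ∈ {z | SampleNoTies sp alg εlo εup z}ᶜ} = 0 := by
    rw [measureReal_eq_zero_iff]
    exact ae_iff.mp hties
  rw [hzero] at hmix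
  -- The experiment is run with exactly `N` observations. A vanishing mixture has vanishing terms,
  -- and the event that all `N` are accepted has weight `(1/B)^N > 0`.
  have hterm := (Finset.sum_eq_zero_iff_of_nonneg (fun j _ =>
    mul_nonneg (binomWeight_nonneg (by positivity) hB1 j) measureReal_nonneg)).mp hmix.symm N
      (by simp)
  rw [mul_eq_zero] at hterm
  rcases hterm with h0 | h0
  · have : 0 < binomWeight N (1 / ratioBound πe πb) N := by
      simp only [binomWeight, Nat.choose_self, Nat.cast_one, one_mul, Nat.sub_self, pow_zero,
        mul_one]
      positivity
    linarith
  · rw [measureReal_eq_zero_iff] at h0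
    exact h0

end Experiment

/-! ### The conditional miscoverage probability -/

/-- By independence the joint law of `(D, T)` is a product, so conditioning on `D` freezes the first
coordinate and integrates out `T` by Fubini. -/
lemma condExp_indicator_of_indepFun {Ω α β : Type*} [MeasurableSpace Ω] [mα : MeasurableSpace α]
    [MeasurableSpace β] {P : Measure Ω} [IsProbabilityMeasure P] {D : Ω → α} {T : Ω → β}
    (hD : Measurable D) (hT : Measurable T) (hind : IndepFun D T P) {S : Set (α × β)}
    (hS : MeasurableSet S) :
    P⟦{ω | (D ω, T ω) ∈ S} | mα.comap D⟧
      =ᵐ[P] fun ω => (P.map T).real (Prod.mk (D ω) ⁻¹' S) := by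
  have hTp := Measure.isProbabilityMeasure_map (μ := P) hT.aemeasurable
  have hSpre : MeasurableSet {ω | (D ω, T ω) ∈ S} := (hD.prodMk hT) hS
  have hm : Measurable fun a => (P.map T) (Prod.mk a ⁻¹' S) := measurable_measure_prodMk_left hS
  have hmr : Measurable fun a => (P.map T).real (Prod.mk a ⁻¹' S) := hm.ennreal_toReal
  have hint : Integrable (fun ω => (P.map T).real (Prod.mk (D ω) ⁻¹' S)) P := by
    refine Integrable.of_bound (hmr.comp hD).aestronglyMeasurable 1 (ae_of_all _ fun ω => ?_)
    rw [Real.norm_of_nonneg measureReal_nonneg]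
    exact measureReal_le_one
  refine (ae_eq_condExp_of_forall_setIntegral_eq hD.comap_le
    ((integrable_const 1).indicator hSpre) (fun _ _ _ => hint.integrableOn) ?_ ?_).symm
  · rintro _ ⟨E, hE, rfl⟩ -
    rw [← setIntegral_map hE (g := D) (f := fun a => (P.map T).real (Prod.mk a ⁻¹' S))
      hmr.aestronglyMeasurable hD.aemeasurable]
    rw [integral_indicator hSpre, Measure.restrict_restrict hSpre, setIntegral_const, smul_eq_mul,
      mul_one, measureReal_def]
    have hset : {ω | (D ω, T ω) ∈ S} ∩ D ⁻¹' E
        = (fun ω => (D ω, T ω)) ⁻¹' (S ∩ E ×ˢ Set.univ) := by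
      ext ω
      simp
    rw [hset, ← Measure.map_apply (hD.prodMk hT) (hS.inter (hE.prod MeasurableSet.univ)),
      (indepFun_iff_map_prod_eq_prod_map_map hD.aemeasurable hT.aemeasurable).mp hind,
      Measure.prod_apply (hS.inter (hE.prod MeasurableSet.univ))]
    have hfib : ∀ a, (P.map T) (Prod.mk a ⁻¹' (S ∩ E ×ˢ Set.univ))
        = E.indicator (fun a => (P.map T) (Prod.mk a ⁻¹' S)) a := by
      intro a
      by_cases ha : a ∈ E
      · rw [Set.indicator_of_mem ha]
        congr 1
        ext b
        simp [ha]
      · rw [Set.indicator_of_notMem ha]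
        have : Prod.mk a ⁻¹' (S ∩ E ×ˢ Set.univ) = ∅ := by
          ext b
          simp [ha]
        rw [this, measure_empty]
    simp only [hfib]
    rw [lintegral_indicator hE]
    exact integral_toReal hm.aemeasurable (ae_of_all _ fun a => measure_lt_top _ _)
  · exact (hmr.comp (comap_measurable D)).stronglyMeasurable.aestronglyMeasurable

section Experiment

variable {𝒮 𝒜 Ω : Type*} [MeasurableSpace 𝒮] [MeasurableSpace 𝒜] [MeasurableSpace Ω]
  {ν : Kernel 𝒮 𝒜} {πe πb : Policy ν} {γ : ℝ} (sp : SplitRule γ) (alg : QuantileAlgorithm 𝒮)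
  (ε δ εlo εup : ℝ)

lemma measurableSet_notMem_predictionInterval (n : ℕ) :
    MeasurableSet {q : ((Fin n → (𝒮 × 𝒜) × ℝ) × (Fin n → ℝ)) × ((𝒮 × 𝒜) × ℝ) |
      q.2.2 ∉ predictionInterval πe πb sp alg ε δ εlo εup q.1.1 q.1.2 q.2.1.1} := by
  have hset : {q : ((Fin n → (𝒮 × 𝒜) × ℝ) × (Fin n → ℝ)) × ((𝒮 × 𝒜) × ℝ) |
      q.2.2 ∉ predictionInterval πe πb sp alg ε δ εlo εup q.1.1 q.1.2 q.2.1.1}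
      = ⋃ A : Finset (Fin n),
        (fun q => (subsample A (fun i => (q.1.1 i, q.1.2 i)), (q.2.1.1, q.2.2))) ⁻¹'
          {q | q.2.2 ∉ calibratedInterval sp alg ε δ εlo εup q.1 q.2.1}
        ∩ (fun q => fun i => (q.1.1 i, q.1.2 i)) ⁻¹' acceptEvent πe πb A := by
    ext q
    simp only [Set.mem_iUnion, Set.mem_inter_iff, Set.mem_preimage]
    constructor
    · intro hq
      exact ⟨_, hq, rfl⟩
    · rintro ⟨A, hA, rfl⟩
      exact hA
  have hy : Measurable fun q : ((Fin n → (𝒮 × 𝒜) × ℝ) × (Fin n → ℝ)) × ((𝒮 × 𝒜) × ℝ) =>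
      fun i => (q.1.1 i, q.1.2 i) := by fun_prop
  rw [hset]
  refine MeasurableSet.iUnion fun A => MeasurableSet.inter ?_ (hy (measurableSet_acceptEvent A))
  exact (((measurable_subsample A).comp hy).prodMk (measurable_contextReward.comp measurable_snd))
    (measurableSet_notMem_calibratedInterval sp alg ε δ εlo εup)

variable [IsSFiniteKernel ν] {P : Measure Ω} {PS : Measure 𝒮} {PR : Kernel (𝒮 × 𝒜) ℝ}
  {X : ℕ → Ω → (𝒮 × 𝒜) × ℝ} {V : ℕ → Ω → ℝ} {T : Ω → (𝒮 × 𝒜) × ℝ}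

lemma IsExperiment.measurable_miscoverage (hexp : IsExperiment P PS PR πe πb X V T) (n : ℕ) :
    Measurable (miscoverage P πe πb sp alg ε δ εlo εup X V T n) := by
  have hle : dataSigma X V n ≤ ‹MeasurableSpace Ω› :=
    Measurable.comap_le ((measurable_pi_lambda _ fun i : Fin n => hexp.measurable_X i).prodMk
      (measurable_pi_lambda _ fun i : Fin n => hexp.measurable_V i))
  exact (stronglyMeasurable_condExp.mono hle).measurable

variable [IsProbabilityMeasure P]

/-- The future point enters only through its context and reward, so the miscoverage is computed
under `targetLaw`, the same law as that of the accepted pairs. -/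
lemma IsExperiment.miscoverage_ae_eq (hexp : IsExperiment P PS PR πe πb X V T) (n : ℕ) :
    miscoverage P πe πb sp alg ε δ εlo εup X V T n =ᵐ[P] fun ω =>
      sampleMiscoverage sp alg ε δ εlo εup (targetLaw PS PR πe)
        (rsSample πe πb (fun i : Fin n => X i ω) (fun i : Fin n => V i ω)) := by
  have hD : Measurable fun ω => ((fun i : Fin n => X i ω), (fun i : Fin n => V i ω)) :=
    (measurable_pi_lambda _ fun i : Fin n => hexp.measurable_X i).prodMk
      (measurable_pi_lambda _ fun i : Fin n => hexp.measurable_V i)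
  have hind : IndepFun (fun ω => ((fun i : Fin n => X i ω), (fun i : Fin n => V i ω))) T P :=
    hexp.indepFun_XV_T.comp
      (φ := fun q : (ℕ → (𝒮 × 𝒜) × ℝ) × (ℕ → ℝ) =>
        ((fun i : Fin n => q.1 i), (fun i : Fin n => q.2 i))) (ψ := id)
      (by fun_prop) measurable_id
  have h := condExp_indicator_of_indepFun hD hexp.measurable_T hind
    (measurableSet_notMem_predictionInterval (πe := πe) (πb := πb) sp alg ε δ εlo εup n)
  refine h.trans (ae_of_all _ fun ω => ?_)
  simp only
  rw [hexp.law_T, sampleMiscoverage, targetLaw, map_measureReal_apply measurable_contextReward]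
  · rfl
  · exact measurable_prodMk_left
      (measurableSet_notMem_calibratedInterval sp alg ε δ εlo εup)

end Experiment

/-! ### Concentration of the miscoverage -/

section Bounds

variable {𝒮 : Type*} [MeasurableSpace 𝒮] {γ : ℝ} (sp : SplitRule γ) (alg : QuantileAlgorithm 𝒮)
  {ε δ : ℝ} (εlo εup : ℝ) {N : ℕ}

/-- The price of truncating the window width `d` at `c`: a constant factor, because `d` is bounded
by `D`. -/
lemma one_div_min_le {d c D : ℝ} (hd : 0 < d) (hc : 0 < c) (hdD : d ≤ D) :
    1 / min d c ≤ (1 + D / c) / d := by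
  rw [div_le_div_iff₀ (lt_min hd hc) hd, one_mul]
  have hD : 0 ≤ D / c := div_nonneg (hd.le.trans hdD) hc.le
  rcases le_total d c with h | h
  · rw [min_eq_left h]
    nlinarith
  · rw [min_eq_right h, add_mul, div_mul_cancel₀ _ hc.ne']
    linarith

/-- The window has probability at least `P(L > ε - d') - P(L > ε)`. The first term is close to `1`
by Chebyshev's inequality and the second is at most `δ` by the choice of the cutoff. -/
lemma le_measureReal_sampleMiscoverage_lower (Q : Measure (𝒮 × ℝ)) [IsProbabilityMeasure Q]
    (hε : ε ∈ Set.Ioo (0 : ℝ) 1) (hδ : δ ∈ Set.Ioo (0 : ℝ) 1) {d D : ℝ} (hd : 0 < d)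
    (hdD : d ≤ D) (hcard : 2 ≤ (sp.calib N).card)
    (hties : ∀ᵐ z ∂(Measure.pi fun _ : Fin N => Q), SampleNoTies sp alg εlo εup z) :
    1 - δ - 2 / δ * (1 + D / (ε / 2)) / (√(sp.calib N).card * d)
      ≤ (Measure.pi fun _ : Fin N => Q).real
          {z | ε - d < sampleMiscoverage sp alg ε δ εlo εup Q z ∧
            sampleMiscoverage sp alg ε δ εlo εup Q z ≤ ε} := by
  set M := (sp.calib N).card
  have hMpos : 0 < M := by omega
  have hMs : 0 < √(M : ℝ) := Real.sqrt_pos.mpr (by exact_mod_cast hMpos)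
  have hε0 := hε.1
  have hε1 := hε.2
  have hδ0 := hδ.1
  -- Truncation keeps the level `ε - d'` inside `(0, 1)`; the window only shrinks.
  set d' := min d (ε / 2) with hd'
  have hd'0 : 0 < d' := lt_min hd (by linarith)
  have hd'1 : d' ≤ ε / 2 := min_le_right _ _
  have h1 := measureReal_lt_sampleMiscoverage sp alg ε δ εlo εup Q (α := ε - d') hδ.1.le
    ⟨by linarith, by linarith⟩ hcard hties
  have h2 := measureReal_lt_sampleMiscoverage sp alg ε δ εlo εup Q hδ.1.le hε hcard hties
  have h3 := one_sub_binomCDF_cutoff_le hMpos hε hδ (α := ε - d') (by linarith) (by linarith)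
  have h4 := (cutoff_mem M (ε := ε) hδ.1.le).2.2
  rw [sub_sub_cancel] at h3
  have h5 : 2 / δ / (√M * d') ≤ 2 / δ * (1 + D / (ε / 2)) / (√M * d) := by
    have := one_div_min_le hd (half_pos hε0) hdD
    calc 2 / δ / (√M * d') = 2 / δ / √M * (1 / d') := by field_simp
      _ ≤ 2 / δ / √M * ((1 + D / (ε / 2)) / d) := by gcongr
      _ = _ := by field_simp
  calc _ ≤ binomCDF M (ε - d') (cutoff M ε δ) - binomCDF M ε (cutoff M ε δ) := by linarith
    _ = _ := by rw [← h1, ← h2]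
    _ ≤ _ := le_measureReal_sdiff
    _ ≤ _ := by
      refine measureReal_mono ?_
      rintro z ⟨hz1, hz2⟩
      have hz1' : ε - d' < sampleMiscoverage sp alg ε δ εlo εup Q z := hz1
      have hz2' : ¬ ε < sampleMiscoverage sp alg ε δ εlo εup Q z := hz2
      exact ⟨by linarith [min_le_left d (ε / 2)], not_lt.mp hz2'⟩

lemma le_measureReal_sampleMiscoverage_upper (Q : Measure (𝒮 × ℝ)) [IsProbabilityMeasure Q]
    (hε : ε ∈ Set.Ioo (0 : ℝ) 1) (hδ : δ ∈ Set.Ioo (0 : ℝ) 1) {d D : ℝ} (hd : 0 < d)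
    (hdD : d ≤ D) (hcard : 2 ≤ (sp.calib N).card)
    (hties : ∀ᵐ z ∂(Measure.pi fun _ : Fin N => Q), SampleNoTies sp alg εlo εup z) :
    δ - (3 / √(ε * (1 - ε)) * D + 2 / (1 - δ) * (1 + D / ((1 - ε) / 2)))
        / (√(sp.calib N).card * d)
      ≤ (Measure.pi fun _ : Fin N => Q).real
          {z | ε < sampleMiscoverage sp alg ε δ εlo εup Q z ∧
            sampleMiscoverage sp alg ε δ εlo εup Q z ≤ ε + d} := by
  set M := (sp.calib N).card
  have hMpos : 0 < M := by omega
  have hMs : 0 < √(M : ℝ) := Real.sqrt_pos.mpr (by exact_mod_cast hMpos)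
  have hε0 := hε.1
  have hε1 : 0 < 1 - ε := by linarith [hε.2]
  have hδ1 : 0 < 1 - δ := by linarith [hδ.2]
  set d' := min d ((1 - ε) / 2) with hd'
  have hd'0 : 0 < d' := lt_min hd (by linarith)
  have hd'1 : d' ≤ (1 - ε) / 2 := min_le_right _ _
  have h1 := measureReal_lt_sampleMiscoverage sp alg ε δ εlo εup Q (α := ε + d') hδ.1.le
    ⟨by linarith, by linarith⟩ hcard hties
  have h2 := measureReal_lt_sampleMiscoverage sp alg ε δ εlo εup Q hδ.1.le hε hcard hties
  have h3 := binomCDF_cutoff_le hMpos hε hδ (α := ε + d') (by linarith) (by linarith)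
  have h4 := sub_le_binomCDF_cutoff hMpos hε hδ
  rw [add_sub_cancel_left] at h3
  have h5 : 2 / (1 - δ) / (√M * d') ≤ 2 / (1 - δ) * (1 + D / ((1 - ε) / 2)) / (√M * d) := by
    have := one_div_min_le hd (half_pos hε1) hdD
    calc 2 / (1 - δ) / (√M * d') = 2 / (1 - δ) / √M * (1 / d') := by field_simp
      _ ≤ 2 / (1 - δ) / √M * ((1 + D / ((1 - ε) / 2)) / d) := by gcongr
      _ = _ := by field_simp
  -- The point mass error `O(1/√M)` is absorbed into the rate `1/(√M d)` through `1 ≤ D / d`.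
  have h6 : 3 / √(ε * (1 - ε)) / √M ≤ 3 / √(ε * (1 - ε)) * D / (√M * d) := by
    rw [mul_comm (√(M : ℝ)) d, ← div_div, mul_div_assoc]
    have : 1 ≤ D / d := (one_le_div hd).mpr hdD
    gcongr
    exact le_mul_of_one_le_right (by positivity) this
  rw [add_div]
  calc _ ≤ binomCDF M ε (cutoff M ε δ) - binomCDF M (ε + d') (cutoff M ε δ) := by linarith
    _ = _ := by rw [← h1, ← h2]
    _ ≤ _ := le_measureReal_sdiff
    _ ≤ _ := by
      refine measureReal_mono ?_
      rintro z ⟨hz1, hz2⟩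
      have hz2' : ¬ ε + d' < sampleMiscoverage sp alg ε δ εlo εup Q z := hz2
      exact ⟨hz1, by linarith [min_le_left d ((1 - ε) / 2)]⟩

end Bounds

/-! ### Averaging over the number of accepted points -/

/-- A constant that absorbs the random size of the accepted sample into an error bound. -/
def mixConst (p γ D K : ℝ) : ℝ :=
  1 + K / √(γ * p / 2) + D / p ^ 2 + √(4 / (γ * p)) * D

/-- By Chebyshev's inequality a `Bin(n, p)` variable is below half its mean with probability at most
`1 / (n p²)`; there only `g ≥ 0` is used. -/
lemma sum_binomWeight_mul_ge {n : ℕ} {p a : ℝ} (hn : 0 < n) (hp0 : 0 < p) (hp1 : p ≤ 1)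
    (ha : a ≤ 1) {g : ℕ → ℝ} (hg0 : ∀ N, 0 ≤ g N)
    (hg : ∀ N : ℕ, n * p / 2 ≤ N → a ≤ g N) :
    a - 1 / (n * p ^ 2) ≤ ∑ N ∈ Finset.range (n + 1), binomWeight n p N * g N := by
  have hn' : (0 : ℝ) < n := by exact_mod_cast hn
  have hdev := sum_binomWeight_deviation_le (M := n) hp0.le hp1
    (s := n * p / 2) (by positivity)
    ((Finset.range (n + 1)).filter fun N : ℕ => (N : ℝ) < n * p / 2) (by
      intro j hj
      have := (Finset.mem_filter.mp hj).2
      exact le_trans (by linarith) (le_abs_self _))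
  have hval : (n : ℝ) / (4 * (n * p / 2) ^ 2) = 1 / (n * p ^ 2) := by
    field_simp
    norm_num
  rw [hval, Finset.sum_filter] at hdev
  calc a - 1 / (n * p ^ 2)
      ≤ a * ∑ N ∈ Finset.range (n + 1), binomWeight n p N
        - ∑ N ∈ Finset.range (n + 1),
            (if (N : ℝ) < n * p / 2 then binomWeight n p N else 0) := by
        rw [sum_binomWeight, mul_one]
        linarith
    _ = ∑ N ∈ Finset.range (n + 1), (a * binomWeight n p N
          - (if (N : ℝ) < n * p / 2 then binomWeight n p N else 0)) := by
        rw [Finset.sum_sub_distrib, Finset.mul_sum]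
    _ ≤ _ := by
        refine Finset.sum_le_sum fun N _ => ?_
        have hw := binomWeight_nonneg (M := n) hp0.le hp1 N
        split_ifs with h
        · have := mul_nonneg hw (hg0 N)
          nlinarith
        · have := hg N (not_lt.mp h)
          nlinarith

/-- Each summand of `mixConst` has one task: `1` makes the inequality strict, `K / √(γ p / 2)` comes
from `M ≥ γ n p / 2`, `D / p²` pays for small `N`, and `√(4 / (γ p)) D` makes the claim trivial for
small `n`. -/
lemma sub_mixConst_div_lt {n : ℕ} {p γ d D K c : ℝ} (hn : 1 ≤ n) (hp0 : 0 < p) (hp1 : p ≤ 1)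
    (hγ : 0 < γ) (hd : 0 < d) (hdD : d ≤ D) (hK : 0 ≤ K) (hc : c ≤ 1) {g : ℕ → ℝ}
    (hg0 : ∀ N, 0 ≤ g N)
    (hg : ∀ N : ℕ, 2 ≤ ⌈γ * (N : ℝ)⌉₊ → 1 ≤ N → c - K / (√(⌈γ * (N : ℝ)⌉₊ : ℝ) * d) ≤ g N) :
    c - mixConst p γ D K / (√(n : ℝ) * d)
      < ∑ N ∈ Finset.range (n + 1), binomWeight n p N * g N := by
  have hn' : (1 : ℝ) ≤ n := by exact_mod_cast hn
  have hs1 : 1 ≤ √(n : ℝ) := Real.one_le_sqrt.mpr hn'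
  have hsn : √(n : ℝ) * √n = n := Real.mul_self_sqrt (by linarith)
  have hD : 0 < D := hd.trans_le hdD
  have hr : 0 < √(n : ℝ) * d := by positivity
  have hc0 : 0 < √(γ * p / 2) := Real.sqrt_pos.mpr (by positivity)
  have hk : 0 ≤ K / √(γ * p / 2) := by positivity
  have hk2 : 0 ≤ D / p ^ 2 := by positivity
  have hk3 : 0 ≤ √(4 / (γ * p)) * D := by positivity
  -- From `n = 4 / (γ p)` on, `N ≥ n p / 2` guarantees at least two calibration points; below it the
  -- subtracted term exceeds `1`.
  rcases lt_or_ge (n : ℝ) (4 / (γ * p)) with hlt | hge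
  · have hsum : 0 ≤ ∑ N ∈ Finset.range (n + 1), binomWeight n p N * g N :=
      Finset.sum_nonneg fun N _ => mul_nonneg (binomWeight_nonneg hp0.le hp1 N) (hg0 N)
    have h1 : √(n : ℝ) * d < mixConst p γ D K := by
      have : √(n : ℝ) * d ≤ √(4 / (γ * p)) * D :=
        mul_le_mul (Real.sqrt_le_sqrt hlt.le) hdD hd.le (Real.sqrt_nonneg _)
      unfold mixConst
      linarith
    have : 1 < mixConst p γ D K / (√(n : ℝ) * d) := (one_lt_div hr).mpr h1
    linarith
  · have hsum := sum_binomWeight_mul_ge (n := n) (a := c - K / √(γ * p / 2) / (√(n : ℝ) * d))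
      (by omega) hp0 hp1
      (by
        have : 0 ≤ K / √(γ * p / 2) / (√(n : ℝ) * d) := by positivity
        linarith) hg0 (by
        intro N hN
        have hγN : γ * (n * p / 2) ≤ γ * N := mul_le_mul_of_nonneg_left hN hγ.le
        have h2 : 2 ≤ γ * (n * p / 2) := by
          rw [div_le_iff₀ (by positivity)] at hge
          linarith
        have hceil : γ * N ≤ (⌈γ * (N : ℝ)⌉₊ : ℝ) := Nat.le_ceil _
        have hN1 : 1 ≤ N := by
          rcases Nat.eq_zero_or_pos N with h0 | h0
          · rw [h0, Nat.cast_zero] at hγN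
            linarith
          · exact h0
        refine le_trans ?_ (hg N (by
          have : (2 : ℝ) ≤ (⌈γ * (N : ℝ)⌉₊ : ℝ) := by linarith
          exact_mod_cast this) hN1)
        have hroot : √(γ * p / 2) * √(n : ℝ) ≤ √(⌈γ * (N : ℝ)⌉₊ : ℝ) := by
          rw [← Real.sqrt_mul (by positivity)]
          apply Real.sqrt_le_sqrt
          linarith
        rw [div_div, ← mul_assoc]
        gcongr)
    have h3 : 1 / ((n : ℝ) * p ^ 2) ≤ D / p ^ 2 / (√(n : ℝ) * d) := by
      rw [div_div, div_le_div_iff₀ (by positivity) (by positivity), one_mul]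
      calc p ^ 2 * (√(n : ℝ) * d) ≤ p ^ 2 * (√(n : ℝ) * √n * D) := by
            gcongr
            exact le_mul_of_one_le_left (by positivity) hs1
        _ = D * (n * p ^ 2) := by
            rw [hsn]
            ring
    have h4 : mixConst p γ D K / (√(n : ℝ) * d)
        = 1 / (√(n : ℝ) * d) + K / √(γ * p / 2) / (√(n : ℝ) * d) + D / p ^ 2 / (√(n : ℝ) * d)
          + √(4 / (γ * p)) * D / (√(n : ℝ) * d) := by
      unfold mixConst
      ring
    have h5 : 0 < 1 / (√(n : ℝ) * d) := by positivity
    have h6 : 0 ≤ √(4 / (γ * p)) * D / (√(n : ℝ) * d) := by positivity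
    linarith

section Experiment

variable {𝒮 𝒜 Ω : Type*} [MeasurableSpace 𝒮] [MeasurableSpace 𝒜] [MeasurableSpace Ω]
  {ν : Kernel 𝒮 𝒜} {πe πb : Policy ν} [IsSFiniteKernel ν] {P : Measure Ω} {PS : Measure 𝒮}
  {PR : Kernel (𝒮 × 𝒜) ℝ} {X : ℕ → Ω → (𝒮 × 𝒜) × ℝ} {V : ℕ → Ω → ℝ} {T : Ω → (𝒮 × 𝒜) × ℝ}
  [IsProbabilityMeasure P] [IsProbabilityMeasure PS] [IsMarkovKernel PR]

/-- Transfer of a bound for i.i.d. samples from the target law to the accepted sample. -/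
lemma IsExperiment.sub_mixConst_div_lt_measureReal (hexp : IsExperiment P PS PR πe πb X V T)
    (h : (dominatingConstants πe πb).Nonempty) {γ : ℝ} (hγ : 0 < γ) (sp : SplitRule γ)
    (alg : QuantileAlgorithm 𝒮) (ε δ εlo εup : ℝ)
    (hties : ∀ n : ℕ, 1 ≤ n → ∀ᵐ ω ∂P, NoTies πe πb sp alg εlo εup
      (fun i : Fin n => X i ω) (fun i : Fin n => V i ω))
    {n : ℕ} (hn : 1 ≤ n) {d D K c : ℝ} (hd : 0 < d) (hdD : d ≤ D) (hK : 0 ≤ K) (hc : c ≤ 1)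
    {s : Set ℝ} (hs : MeasurableSet s)
    (hbound : ∀ N : ℕ, 2 ≤ (sp.calib N).card →
      (∀ᵐ z ∂(Measure.pi fun _ : Fin N => targetLaw PS PR πe), SampleNoTies sp alg εlo εup z) →
      c - K / (√((sp.calib N).card : ℝ) * d)
        ≤ (Measure.pi fun _ : Fin N => targetLaw PS PR πe).real
          {z | sampleMiscoverage sp alg ε δ εlo εup (targetLaw PS PR πe) z ∈ s}) :
    c - mixConst (1 / ratioBound πe πb) γ D K / (√(n : ℝ) * d)
      < P.real {ω | miscoverage P πe πb sp alg ε δ εlo εup X V T n ω ∈ s} := by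
  have : Nonempty 𝒮 := nonempty_of_isProbabilityMeasure PS
  have hB := one_le_ratioBound h
  have hB1 : 1 / ratioBound πe πb ≤ 1 := by
    rw [div_le_one (by linarith)]
    exact hB
  have hmix := hexp.measureReal_rsSample_mem h n
    (Φ := fun N => {z | sampleMiscoverage sp alg ε δ εlo εup (targetLaw PS PR πe) z ∈ s})
    fun N => measurable_sampleMiscoverage sp alg ε δ εlo εup _ hs
  have hae : P.real {ω | miscoverage P πe πb sp alg ε δ εlo εup X V T n ω ∈ s}
      = P.real {ω | rsSample πe πb (fun i : Fin n => X i ω) (fun i : Fin n => V i ω) ∈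
        {z | sampleMiscoverage sp alg ε δ εlo εup (targetLaw PS PR πe) z ∈ s}} := by
    refine measureReal_congr ?_
    filter_upwards [hexp.miscoverage_ae_eq sp alg ε δ εlo εup n] with ω hω
    apply propext
    change miscoverage P πe πb sp alg ε δ εlo εup X V T n ω ∈ s
      ↔ sampleMiscoverage _ _ _ _ _ _ _ _ ∈ s
    rw [hω]
  rw [hae, hmix]
  refine sub_mixConst_div_lt hn (by positivity) hB1 hγ hd hdD hK hc
    (fun N => measureReal_nonneg) fun N hN hN1 => ?_
  rw [← sp.card_calib N] at hN ⊢
  exact hbound N hN (hexp.ae_sampleNoTies h sp alg εlo εup N (hties N hN1))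

end Experiment

lemma mixConst_pos {p γ D K : ℝ} (hK : 0 ≤ K) (hD : 0 ≤ D) : 0 < mixConst p γ D K := by
  unfold mixConst
  positivity

end OffPolicy

end

/-! ### The main theorem -/

theorem corollary1 (ε δ γ B : ℝ) (hε : ε ∈ Set.Ioo (0 : ℝ) 1) (hδ : δ ∈ Set.Ioo (0 : ℝ) 1)
    (hγ : γ ∈ Set.Ioo (0 : ℝ) 1) (Δ : ℕ → ℝ) (hΔpos : ∀ n, 1 ≤ n → 0 < Δ n)
    (hΔ : Tendsto Δ atTop (𝓝 0))
    (hΔn : Tendsto (fun n : ℕ => 1 / (√(n : ℝ) * Δ n)) atTop (𝓝 0)) :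
    ∃ C : ℝ, 0 < C ∧
      ∀ (𝒮 𝒜 Ω : Type*) [MeasurableSpace 𝒮] [MeasurableSpace 𝒜] [MeasurableSpace Ω]
        (P : Measure Ω) [IsProbabilityMeasure P] (PS : Measure 𝒮) [IsProbabilityMeasure PS]
        (PR : Kernel (𝒮 × 𝒜) ℝ) [IsMarkovKernel PR] (ν : Kernel 𝒮 𝒜) [IsSFiniteKernel ν]
        (πe πb : OffPolicy.Policy ν) (sp : OffPolicy.SplitRule γ)
        (alg : OffPolicy.QuantileAlgorithm 𝒮) (εlo εup : ℝ)
        (X : ℕ → Ω → (𝒮 × 𝒜) × ℝ) (V : ℕ → Ω → ℝ) (T : Ω → (𝒮 × 𝒜) × ℝ),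
        (OffPolicy.dominatingConstants πe πb).Nonempty →
        OffPolicy.ratioBound πe πb = B →
        εup - εlo = 1 - ε →
        OffPolicy.IsExperiment P PS PR πe πb X V T →
        (∀ n : ℕ, 1 ≤ n → ∀ᵐ ω ∂P, OffPolicy.NoTies πe πb sp alg εlo εup
          (fun i : Fin n => X i ω) (fun i : Fin n => V i ω)) →
        (∀ n : ℕ, 1 ≤ n →
          P.real {ω | ε - Δ n < OffPolicy.miscoverage P πe πb sp alg ε δ εlo εup X V T n ω ∧
              OffPolicy.miscoverage P πe πb sp alg ε δ εlo εup X V T n ω ≤ ε}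
            > 1 - δ - C / (√(n : ℝ) * Δ n) ∧
          P.real {ω | ε < OffPolicy.miscoverage P πe πb sp alg ε δ εlo εup X V T n ω ∧
              OffPolicy.miscoverage P πe πb sp alg ε δ εlo εup X V T n ω ≤ ε + Δ n}
            > δ - C / (√(n : ℝ) * Δ n)) ∧
        Tendsto (fun n : ℕ =>
          P.real {ω | ε - Δ n < OffPolicy.miscoverage P πe πb sp alg ε δ εlo εup X V T n ω ∧
              OffPolicy.miscoverage P πe πb sp alg ε δ εlo εup X V T n ω ≤ ε + Δ n})
          atTop (𝓝 1) ∧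
        TendstoInMeasure P
          (fun (n : ℕ) ω => 1 - OffPolicy.miscoverage P πe πb sp alg ε δ εlo εup X V T n ω)
          atTop (fun _ => 1 - ε) := by
  have hε0 := hε.1
  have hε1 : 0 < 1 - ε := by linarith [hε.2]
  have hδ0 := hδ.1
  have hδ1 : 0 < 1 - δ := by linarith [hδ.2]
  -- The constant sees the sequence only through this upper bound `D`, and it is fixed before any
  -- experiment is introduced.
  obtain ⟨D, hD⟩ := hΔ.bddAbove_range
  have hDle : ∀ n, Δ n ≤ D := fun n => hD ⟨n, rfl⟩
  have hD0 : 0 < D := (hΔpos 1 le_rfl).trans_le (hDle 1)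
  set K₁ := 2 / δ * (1 + D / (ε / 2))
  set K₂ := 3 / √(ε * (1 - ε)) * D + 2 / (1 - δ) * (1 + D / ((1 - ε) / 2))
  have hK₁ : 0 ≤ K₁ := by positivity
  have hK₂ : 0 ≤ K₂ := by positivity
  set C₁ := OffPolicy.mixConst (1 / B) γ D K₁
  set C₂ := OffPolicy.mixConst (1 / B) γ D K₂
  have hC₁ : 0 < C₁ := OffPolicy.mixConst_pos hK₁ hD0.le
  have hC₂ : 0 < C₂ := OffPolicy.mixConst_pos hK₂ hD0.le
  refine ⟨C₁ + C₂, by positivity, ?_⟩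
  intro 𝒮 𝒜 Ω _ _ _ P _ PS _ PR _ ν _ πe πb sp alg εlo εup X V T hdom hB _ hexp hties
  subst hB
  set L := OffPolicy.miscoverage P πe πb sp alg ε δ εlo εup X V T with hL
  have hmain : ∀ n : ℕ, 1 ≤ n →
      P.real {ω | ε - Δ n < L n ω ∧ L n ω ≤ ε} > 1 - δ - (C₁ + C₂) / (√(n : ℝ) * Δ n) ∧
      P.real {ω | ε < L n ω ∧ L n ω ≤ ε + Δ n} > δ - (C₁ + C₂) / (√(n : ℝ) * Δ n) := by
    intro n hn
    have hΔn0 := hΔpos n hn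
    have hr : 0 < √(n : ℝ) * Δ n := mul_pos (Real.sqrt_pos.mpr (by exact_mod_cast hn)) hΔn0
    have h1 := hexp.sub_mixConst_div_lt_measureReal hdom hγ.1 sp alg ε δ εlo εup hties hn
      hΔn0 (hDle n) hK₁ (by linarith : 1 - δ ≤ 1) (measurableSet_Ioc (a := ε - Δ n) (b := ε))
      fun N hN hN' => OffPolicy.le_measureReal_sampleMiscoverage_lower sp alg εlo εup _ hε hδ hΔn0
        (hDle n) hN hN'
    have h2 := hexp.sub_mixConst_div_lt_measureReal hdom hγ.1 sp alg ε δ εlo εup hties hn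
      hΔn0 (hDle n) hK₂ (by linarith : δ ≤ 1) (measurableSet_Ioc (a := ε) (b := ε + Δ n))
      fun N hN hN' => OffPolicy.le_measureReal_sampleMiscoverage_upper sp alg εlo εup _ hε hδ hΔn0
        (hDle n) hN hN'
    have h3 : 0 < C₁ / (√(n : ℝ) * Δ n) := by positivity
    have h4 : 0 < C₂ / (√(n : ℝ) * Δ n) := by positivity
    rw [add_div]
    refine ⟨lt_of_le_of_lt ?_ h1, lt_of_le_of_lt ?_ h2⟩ <;> linarith
  have hmeasL : ∀ n, Measurable (L n) := fun n =>
    hexp.measurable_miscoverage sp alg ε δ εlo εup n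
  -- The two windows are disjoint and adjacent, so their bounds add up and `(1 - δ) + δ = 1` removes
  -- `δ`.
  have hlower : ∀ n : ℕ, 1 ≤ n → 1 - 2 * (C₁ + C₂) * (1 / (√(n : ℝ) * Δ n))
      ≤ P.real {ω | ε - Δ n < L n ω ∧ L n ω ≤ ε + Δ n} := by
    intro n hn
    have hΔn0 := hΔpos n hn
    obtain ⟨h1, h2⟩ := hmain n hn
    have hunion : {ω | ε - Δ n < L n ω ∧ L n ω ≤ ε + Δ n}
        = {ω | ε - Δ n < L n ω ∧ L n ω ≤ ε} ∪ {ω | ε < L n ω ∧ L n ω ≤ ε + Δ n} := by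
      ext ω
      constructor
      · rintro ⟨h3, h4⟩
        rcases le_or_gt (L n ω) ε with h5 | h5
        · exact Or.inl ⟨h3, h5⟩
        · exact Or.inr ⟨h5, h4⟩
      · rintro (⟨h3, h4⟩ | ⟨h3, h4⟩)
        · exact ⟨h3, by linarith⟩
        · exact ⟨by linarith, h4⟩
    rw [hunion, measureReal_union]
    · have e : 2 * (C₁ + C₂) * (1 / (√(n : ℝ) * Δ n))
          = (C₁ + C₂) / (√(n : ℝ) * Δ n) + (C₁ + C₂) / (√(n : ℝ) * Δ n) := by ring
      rw [e]
      linarith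
    · rw [Set.disjoint_left]
      rintro ω ⟨-, h3⟩ ⟨h4, -⟩
      exact absurd h3 (not_le.mpr h4)
    · exact hmeasL n measurableSet_Ioc
  have hlim : Tendsto (fun n : ℕ => P.real {ω | ε - Δ n < L n ω ∧ L n ω ≤ ε + Δ n})
      atTop (𝓝 1) := by
    have hlow : Tendsto (fun n : ℕ => 1 - 2 * (C₁ + C₂) * (1 / (√(n : ℝ) * Δ n))) atTop (𝓝 1) := by
      simpa using (hΔn.const_mul (2 * (C₁ + C₂))).const_sub 1
    refine tendsto_of_tendsto_of_tendsto_of_le_of_le' hlow tendsto_const_nhds ?_ ?_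
    · filter_upwards [eventually_ge_atTop 1] with n hn using hlower n hn
    · exact Eventually.of_forall fun n => measureReal_le_one
  refine ⟨hmain, hlim, ?_⟩
  rw [tendstoInMeasure_iff_measureReal_dist]
  intro η hη
  have hcompl : Tendsto (fun n : ℕ => 1 - P.real {ω | ε - Δ n < L n ω ∧ L n ω ≤ ε + Δ n})
      atTop (𝓝 0) := by
    simpa using hlim.const_sub 1
  refine squeeze_zero' (Eventually.of_forall fun n => measureReal_nonneg) ?_ hcompl
  -- Once `Δ n < η`, a deviation of at least `η` puts the miscoverage outside the combined window.
  filter_upwards [hΔ.eventually (eventually_lt_nhds hη)] with n hn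
  have hms : MeasurableSet {ω | ε - Δ n < L n ω ∧ L n ω ≤ ε + Δ n} := hmeasL n measurableSet_Ioc
  rw [← probReal_compl_eq_one_sub hms]
  refine measureReal_mono fun ω hω hmem => ?_
  obtain ⟨h1, h2⟩ := hmem
  have hω' : η ≤ |1 - L n ω - (1 - ε)| := hω
  rw [le_abs] at hω'
  rcases hω' with h | h <;> linarith
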